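/- Let $S_1,\dots,S_5$ be the contracting similarities of $\mathbb{R}^2$ given by $S_2(x)=\tfrac12x+(1,0)$ and $S_k(x)=\tfrac14x+a_k$ for $k=1,3,4,5$, where $a_1=(0,0)$, $a_3=(3,0)$, $a_4=(1,\sqrt3)$, $a_5=(\tfrac32,\tfrac{3\sqrt3}{2})$. There is exactly one nonempty compact set $K\subset\mathbb{R}^2$ with $K=\bigcup_{k=1}^5S_k(K)$ (the attractor of the system), and it has the following properties. 1. $K$ is a dendrite, i.e. a compact, connected, locally connected set that contains no simple closed curve. 2. Every non-degenerate line segment contained in $K$ is parallel to the $x$-axis and is contained in a maximal line segment of $K$, whose length is $2^{2-n}$ for some integer $n\ge 0$. 3. Every affine map $f:\mathbb{R}^2\to\mathbb{R}^2$ that is injective on $K$ and satisfies $f(K)\subset K$ is a composition $S_{i_1}\circ\cdots\circ S_{i_k}$ with $k\ge 0$ (for $k=0$ this is the identity). 4. $K$ is not the attractor of any self-similar zipper in $\mathbb{R}^2$, nor of any self-affine one. Here a zipper with vertices $(z_0,\dots,z_m)$ and signature $(\varepsilon_1,\dots,\varepsilon_m)\in\{0,1\}^m$ is a system of injective contractions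 $\varphi_1,\dots,\varphi_m$ such that $\varphi_j(z_0)=z_{j-1+\varepsilon_j}$ and $\varphi_j(z_m)=z_{j-\varepsilon_j}$ for all $j$; it is self-similar (self-affine) if all $\varphi_j$ are similarities (affine maps); its attractor is the nonempty compact set $L$ with $L=\bigcup_{j=1}^m\varphi_j(L)$. Consequently there is a connected attractor of a finite system of contracting similarities of $\mathbb{R}^2$ that is not the attractor of any self-similar zipper in $\mathbb{R}^2$. -/

import Mathlib

/-- The Euclidean plane. -/
abbrev Plane : Type := EuclideanSpace ℝ (Fin 2)

/-- `K` is the attractor (invariant set) of the finite system `F`: a nonempty compact set with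
`K = ⋃ i, F i (K)`. -/
def IsAttractor {X : Type*} [MetricSpace X] {m : ℕ} (F : Fin m → X → X) (K : Set X) : Prop :=
  K.Nonempty ∧ IsCompact K ∧ K = ⋃ i, F i '' K

/-- A similarity with ratio `r > 0`. -/
def IsSimilarity {X : Type*} [MetricSpace X] (f : X → X) : Prop :=
  ∃ r : ℝ, 0 < r ∧ ∀ x y, dist (f x) (f y) = r * dist x y

/-- A contraction: a Lipschitz map with some constant `c < 1`. -/
def IsContraction {X : Type*} [MetricSpace X] (f : X → X) : Prop :=
  ∃ c : NNReal, ContractingWith c f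

/-- The injective contractions `φ 0, …, φ (m - 1)` form a zipper with vertices `z 0, …, z m` and
signature `ε` (`true` stands for `1`). Since the maps are numbered from `0` here, the vertices
`z_{j-1}` and `z_j` belonging to the `j`-th map are `z j.castSucc` and `z j.succ`. -/
structure IsZipper {X : Type*} [MetricSpace X] {m : ℕ} (φ : Fin m → X → X)
    (z : Fin (m + 1) → X) (ε : Fin m → Bool) : Prop where
  injective : ∀ j, Function.Injective (φ j)
  contraction : ∀ j, IsContraction (φ j)
  map_initial : ∀ j, φ j (z 0) = if ε j then z j.succ else z j.castSucc
  map_final : ∀ j, φ j (z (Fin.last m)) = if ε j then z j.castSucc else z j.succ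

/-- `K` is the attractor of some self-similar zipper (all maps are similarities). -/
def IsSelfSimilarZipperAttractor {X : Type*} [MetricSpace X] (K : Set X) : Prop :=
  ∃ (m : ℕ) (φ : Fin m → X → X) (z : Fin (m + 1) → X) (ε : Fin m → Bool),
    IsZipper φ z ε ∧ (∀ j, IsSimilarity (φ j)) ∧ IsAttractor φ K

/-- `K` is the attractor of some self-affine zipper (all maps are affine). -/
def IsSelfAffineZipperAttractor (K : Set Plane) : Prop :=
  ∃ (m : ℕ) (φ : Fin m → Plane → Plane) (z : Fin (m + 1) → Plane) (ε : Fin m → Bool),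
    IsZipper φ z ε ∧ (∀ j, ∃ g : Plane →ᵃ[ℝ] Plane, ⇑g = φ j) ∧ IsAttractor φ K

/-- A dendrite: a locally connected continuum containing no simple closed curve. -/
structure IsDendrite {X : Type*} [MetricSpace X] (K : Set X) : Prop where
  isCompact : IsCompact K
  isConnected : IsConnected K
  locallyConnected : LocallyConnectedSpace K
  no_simple_closed_curve :
    ¬ ∃ γ : Circle → X, Continuous γ ∧ Function.Injective γ ∧ Set.range γ ⊆ K

/-- The system `S₁, …, S₅` (numbered from `0`). -/
noncomputable def dendriteSystem : Fin 5 → Plane → Plane :=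
  ![fun p => (1 / 4 : ℝ) • p + !₂[(0 : ℝ), 0],
    fun p => (1 / 2 : ℝ) • p + !₂[(1 : ℝ), 0],
    fun p => (1 / 4 : ℝ) • p + !₂[(3 : ℝ), 0],
    fun p => (1 / 4 : ℝ) • p + !₂[(1 : ℝ), Real.sqrt 3],
    fun p => (1 / 4 : ℝ) • p + !₂[(3 / 2 : ℝ), 3 * Real.sqrt 3 / 2]]

/-- The composition `F i₁ ∘ … ∘ F iₖ` along a word; the empty word gives the identity. -/
def wordMap {X : Type*} {m : ℕ} (F : Fin m → X → X) : List (Fin m) → X → X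
  | [] => id
  | i :: w => F i ∘ wordMap F w

/-- `[p, q]` is a maximal line segment in `K`. -/
def IsMaximalSegment (K : Set Plane) (p q : Plane) : Prop :=
  segment ℝ p q ⊆ K ∧
    ∀ p' q' : Plane, segment ℝ p' q' ⊆ K → segment ℝ p q ⊆ segment ℝ p' q' →
      segment ℝ p' q' = segment ℝ p q

/-! In skew coordinates the pieces of `K` lie in five homothetic copies of the triangle `T`, and two
of these copies meet in at most one point, a common vertex. Hence the pieces are joined like beads.
Connectedness passes to the limit, pieces of small diameter give local connectedness, and a simple
closed curve, which cannot cross a contact point, is trapped in ever smaller pieces.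

A slanted segment in `K` would have a slanted preimage in some piece. Comparing extents at all
scales shows that its height is zero (`ExtentLE.improve`). A horizontal segment above the base lies
in one piece, so repeated magnification carries it to the base.

The core is the rigidity statement `affine_eq_wordMap`. Along its base `K` carries homothetic copies
of the branch `U` at `(2, 0)`. An injective affine self-map sends the base into a copy of the base.
Undoing that copy and restricting to a small copy of `K` around `(2, 0)` gives a self-map of `K`
with linear part `(x, y) ↦ (a x + b y, d y)`. Connectedness forces branches into branches, and two
estimates pin the map down. Roots of distinct branches are at least six times the smaller ratio
apart (`Br.separation`), which gives `d ≤ |a|`. A slice of `U` at height `y` has width at most `y /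
2`, with equality only on special rungs (`width_U`), which gives `|a| ≤ d` and `b = 0`. The lopsided
shape of `U` excludes `a < 0`. What remains is a homothety, and the branch that receives `U`
identifies it as a word.

Consequently every map of an affine zipper with attractor `K` is a homothety. Homotheties preserve
the direction from the first vertex to the last, so all vertices, and with them the attractor, lie
on one line. But `K` contains three non-collinear points. Similarities of the plane are affine, so
self-similar zippers are covered too. -/

namespace DendriteModel

open Set Filter Topology

/-! ### The system in skew coordinates. -/

/-- The contraction ratios of the system. -/
noncomputable def ratio : Fin 5 → ℝ := ![1 / 4, 1 / 2, 1 / 4, 1 / 4, 1 / 4]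

/-- The translation vectors of the system in skew coordinates. -/
noncomputable def shift : Fin 5 → ℝ × ℝ := ![(0, 0), (1, 0), (3, 0), (0, 2), (0, 3)]

/-- The system in skew coordinates, in which the triangle spanned by the three extreme points of
the attractor is `{(x, y) | 0 ≤ x, 0 ≤ y, x + y ≤ 4}`. -/
noncomputable def S (k : Fin 5) (z : ℝ × ℝ) : ℝ × ℝ := ratio k • z + shift k

/-- The inverse of `S k`. -/
noncomputable def Sinv (k : Fin 5) (z : ℝ × ℝ) : ℝ × ℝ := (ratio k)⁻¹ • (z - shift k)

@[simp] lemma S_zero (z : ℝ × ℝ) : S 0 z = (z.1 / 4, z.2 / 4) := by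
  ext <;> simp [S, ratio, shift] <;> ring

@[simp] lemma S_one (z : ℝ × ℝ) : S 1 z = (z.1 / 2 + 1, z.2 / 2) := by
  ext <;> simp [S, ratio, shift] <;> ring

@[simp] lemma S_two (z : ℝ × ℝ) : S 2 z = (z.1 / 4 + 3, z.2 / 4) := by
  ext <;> simp [S, ratio, shift] <;> ring

@[simp] lemma S_three (z : ℝ × ℝ) : S 3 z = (z.1 / 4, z.2 / 4 + 2) := by
  ext <;> simp [S, ratio, shift] <;> ring

@[simp] lemma S_four (z : ℝ × ℝ) : S 4 z = (z.1 / 4, z.2 / 4 + 3) := by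
  ext <;> simp [S, ratio, shift] <;> ring

@[simp] lemma Sinv_zero (z : ℝ × ℝ) : Sinv 0 z = (4 * z.1, 4 * z.2) := by
  ext <;> simp [Sinv, ratio, shift]

@[simp] lemma Sinv_one (z : ℝ × ℝ) : Sinv 1 z = (2 * (z.1 - 1), 2 * z.2) := by
  ext <;> simp [Sinv, ratio, shift]

@[simp] lemma Sinv_two (z : ℝ × ℝ) : Sinv 2 z = (4 * (z.1 - 3), 4 * z.2) := by
  ext <;> simp [Sinv, ratio, shift]

@[simp] lemma Sinv_three (z : ℝ × ℝ) : Sinv 3 z = (4 * z.1, 4 * (z.2 - 2)) := by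
  ext <;> simp [Sinv, ratio, shift]

@[simp] lemma Sinv_four (z : ℝ × ℝ) : Sinv 4 z = (4 * z.1, 4 * (z.2 - 3)) := by
  ext <;> simp [Sinv, ratio, shift]

lemma ratio_pos (k : Fin 5) : 0 < ratio k := by
  fin_cases k <;> norm_num [ratio]

lemma ratio_le (k : Fin 5) : ratio k ≤ 1 / 2 := by
  fin_cases k <;> norm_num [ratio]

@[simp] lemma S_Sinv (k : Fin 5) (z : ℝ × ℝ) : S k (Sinv k z) = z := by
  simp [S, Sinv, smul_smul, (ratio_pos k).ne']

@[simp] lemma Sinv_S (k : Fin 5) (z : ℝ × ℝ) : Sinv k (S k z) = z := by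
  simp [S, Sinv, smul_smul, (ratio_pos k).ne']

lemma S_injective (k : Fin 5) : Function.Injective (S k) :=
  Function.LeftInverse.injective (Sinv_S k)

lemma mem_S_image {k : Fin 5} {X : Set (ℝ × ℝ)} {z : ℝ × ℝ} : z ∈ S k '' X ↔ Sinv k z ∈ X :=
  ⟨by rintro ⟨y, hy, rfl⟩; simpa, fun h => ⟨_, h, S_Sinv k z⟩⟩

lemma continuous_S (k : Fin 5) : Continuous (S k) := by unfold S; fun_prop

lemma continuous_Sinv (k : Fin 5) : Continuous (Sinv k) := by unfold Sinv; fun_prop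

lemma S_sub (k : Fin 5) (z w : ℝ × ℝ) : S k z - S k w = ratio k • (z - w) := by
  simp [S, smul_sub]

lemma dist_S (k : Fin 5) (z w : ℝ × ℝ) : dist (S k z) (S k w) = ratio k * dist z w := by
  rw [dist_eq_norm, S_sub, norm_smul, dist_eq_norm, Real.norm_of_nonneg (ratio_pos k).le]

/-! ### Construction of the attractor as a decreasing intersection. -/

/-- The triangle spanned by the extreme points of the attractor. -/
def T : Set (ℝ × ℝ) := {z | 0 ≤ z.1 ∧ 0 ≤ z.2 ∧ z.1 + z.2 ≤ 4}

/-- The set operator whose fixed point is the attractor. -/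
def hutch (X : Set (ℝ × ℝ)) : Set (ℝ × ℝ) := ⋃ k, S k '' X

/-- The decreasing approximations of the attractor. -/
def approx : ℕ → Set (ℝ × ℝ)
  | 0 => T
  | n + 1 => hutch (approx n)

/-- The attractor in skew coordinates. -/
def K : Set (ℝ × ℝ) := ⋂ n, approx n

lemma forall_fin5 {P : Fin 5 → Prop} : (∀ k, P k) ↔ P 0 ∧ P 1 ∧ P 2 ∧ P 3 ∧ P 4 := by
  simp [Fin.forall_fin_succ]

lemma exists_fin5 {P : Fin 5 → Prop} : (∃ k, P k) ↔ P 0 ∨ P 1 ∨ P 2 ∨ P 3 ∨ P 4 := by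
  simp [Fin.exists_fin_succ]

lemma isClosed_T : IsClosed T :=
  (isClosed_le continuous_const continuous_fst).inter
    ((isClosed_le continuous_const continuous_snd).inter
      (isClosed_le (continuous_fst.add continuous_snd) continuous_const))

lemma isCompact_T : IsCompact T := by
  refine (isCompact_Icc (a := ((0 : ℝ), (0 : ℝ))) (b := (4, 4))).of_isClosed_subset isClosed_T ?_
  rintro ⟨x, y⟩ ⟨h1, h2, h3⟩
  simp only [Set.mem_Icc, Prod.mk_le_mk] at *
  exact ⟨⟨h1, h2⟩, by linarith, by linarith⟩

lemma S_mem_T (k : Fin 5) {z : ℝ × ℝ} (hz : z ∈ T) : S k z ∈ T := by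
  obtain ⟨h1, h2, h3⟩ := hz
  revert k
  rw [forall_fin5]
  simp only [S_zero, S_one, S_two, S_three, S_four, T, mem_ofPred_eq]
  refine ⟨⟨?_, ?_, ?_⟩, ⟨?_, ?_, ?_⟩, ⟨?_, ?_, ?_⟩, ⟨?_, ?_, ?_⟩, ⟨?_, ?_, ?_⟩⟩ <;> linarith

lemma hutch_mono {X Y : Set (ℝ × ℝ)} (h : X ⊆ Y) : hutch X ⊆ hutch Y :=
  iUnion_mono fun _ => image_mono h

lemma approx_succ_subset (n : ℕ) : approx (n + 1) ⊆ approx n := by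
  induction n with
  | zero =>
    refine iUnion_subset fun k => ?_
    rintro _ ⟨z, hz, rfl⟩
    exact S_mem_T k hz
  | succ n ih => exact hutch_mono ih

lemma approx_antitone : Antitone approx := antitone_nat_of_succ_le approx_succ_subset

lemma isCompact_approx (n : ℕ) : IsCompact (approx n) := by
  induction n with
  | zero => exact isCompact_T
  | succ n ih => exact isCompact_iUnion fun k => ih.image (continuous_S k)

lemma isClosed_K : IsClosed K := isClosed_iInter fun n => (isCompact_approx n).isClosed

lemma isCompact_K : IsCompact K :=
  isCompact_T.of_isClosed_subset isClosed_K (iInter_subset _ 0)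

lemma K_subset_T : K ⊆ T := iInter_subset _ 0

lemma S_mem_K (k : Fin 5) {z : ℝ × ℝ} (hz : z ∈ K) : S k z ∈ K := by
  refine mem_iInter.2 fun n => approx_succ_subset n ?_
  exact mem_iUnion.2 ⟨k, z, mem_iInter.1 hz n, rfl⟩

/-- A point outside all five pieces leaves each of them at some finite stage. The largest of these
stages contradicts membership in the next approximation. -/
lemma exists_mem_S_image {z : ℝ × ℝ} (hz : z ∈ K) : ∃ k, z ∈ S k '' K := by
  by_contra! h
  have h' : ∀ k, ∃ n, Sinv k z ∉ approx n := fun k => by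
    have := h k
    rw [mem_S_image, K, mem_iInter] at this
    exact not_forall.1 this
  choose n hn using h'
  obtain ⟨k, hk⟩ := mem_iUnion.1 (mem_iInter.1 hz (Finset.univ.sup n + 1))
  exact hn k (approx_antitone (Finset.le_sup (Finset.mem_univ k)) (mem_S_image.1 hk))

lemma K_eq : K = ⋃ k, S k '' K := by
  refine Subset.antisymm (fun z hz => mem_iUnion.2 (exists_mem_S_image hz)) ?_
  refine iUnion_subset fun k => ?_
  rintro _ ⟨z, hz, rfl⟩
  exact S_mem_K k hz

lemma vertices_mem_hutch {X : Set (ℝ × ℝ)} (hA : ((0, 0) : ℝ × ℝ) ∈ X) (hB : ((4, 0) : ℝ × ℝ) ∈ X)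
    (hC : ((0, 4) : ℝ × ℝ) ∈ X) :
    ((0, 0) : ℝ × ℝ) ∈ hutch X ∧ ((4, 0) : ℝ × ℝ) ∈ hutch X ∧ ((0, 4) : ℝ × ℝ) ∈ hutch X := by
  refine ⟨mem_iUnion.2 ⟨0, _, hA, ?_⟩, mem_iUnion.2 ⟨2, _, hB, ?_⟩, mem_iUnion.2 ⟨4, _, hC, ?_⟩⟩
  all_goals norm_num

lemma approx_vertices (n : ℕ) : ((0, 0) : ℝ × ℝ) ∈ approx n ∧ ((4, 0) : ℝ × ℝ) ∈ approx n ∧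
    ((0, 4) : ℝ × ℝ) ∈ approx n := by
  induction n with
  | zero => norm_num [approx, T]
  | succ n ih => exact vertices_mem_hutch ih.1 ih.2.1 ih.2.2

lemma A_mem_K : ((0, 0) : ℝ × ℝ) ∈ K := mem_iInter.2 fun n => (approx_vertices n).1
lemma B_mem_K : ((4, 0) : ℝ × ℝ) ∈ K := mem_iInter.2 fun n => (approx_vertices n).2.1
lemma C_mem_K : ((0, 4) : ℝ × ℝ) ∈ K := mem_iInter.2 fun n => (approx_vertices n).2.2

/-- The maps `S 0`, `S 1`, `S 2` tile the base by copies of itself over `[0, 1]`, `[1, 3]` and `[3,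
4]`. -/
lemma base_mem_K {x : ℝ} (h0 : 0 ≤ x) (h4 : x ≤ 4) : ((x, 0) : ℝ × ℝ) ∈ K := by
  refine mem_iInter.2 fun n => ?_
  induction n generalizing x with
  | zero => exact ⟨h0, le_rfl, by simpa using h4⟩
  | succ n ih =>
    refine mem_iUnion.2 ?_
    simp only [mem_S_image]
    rcases le_total x 1 with h1 | h1
    · exact ⟨0, by simpa using ih (x := 4 * x) (by linarith) (by linarith)⟩
    rcases le_total x 3 with h3 | h3
    · exact ⟨1, by simpa using ih (x := 2 * (x - 1)) (by linarith) (by linarith)⟩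
    · exact ⟨2, by simpa using ih (x := 4 * (x - 3)) (by linarith) (by linarith)⟩

/-! ### Connectedness. -/

lemma isPreconnected_hutch {X : Set (ℝ × ℝ)} (hX : IsPreconnected X)
    (hA : ((0, 0) : ℝ × ℝ) ∈ X) (hB : ((4, 0) : ℝ × ℝ) ∈ X) (hC : ((0, 4) : ℝ × ℝ) ∈ X) :
    IsPreconnected (hutch X) := by
  have hS : ∀ k, IsPreconnected (S k '' X) := fun k => hX.image _ (continuous_S k).continuousOn
  have h12 := IsPreconnected.union (1, 0) (s := S 0 '' X) (t := S 1 '' X)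
    ⟨_, hB, by norm_num⟩ ⟨_, hA, by norm_num⟩ (hS 0) (hS 1)
  have h123 := IsPreconnected.union (3, 0) (t := S 2 '' X) (Or.inr ⟨_, hB, by norm_num⟩)
    ⟨_, hA, by norm_num⟩ h12 (hS 2)
  have h45 := IsPreconnected.union (0, 3) (s := S 3 '' X) (t := S 4 '' X)
    ⟨_, hC, by norm_num⟩ ⟨_, hA, by norm_num⟩ (hS 3) (hS 4)
  have h := IsPreconnected.union (1, 2) (Or.inl (Or.inr ⟨_, hC, by norm_num⟩))
    (Or.inl ⟨_, hB, by norm_num⟩) h123 h45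
  convert h using 1
  ext z
  simp only [hutch, mem_iUnion, exists_fin5, mem_union]
  tauto

lemma isPreconnected_approx (n : ℕ) : IsPreconnected (approx n) := by
  induction n with
  | zero =>
    refine Convex.isPreconnected ?_
    rintro ⟨x, y⟩ ⟨h1, h2, h3⟩ ⟨x', y'⟩ ⟨h1', h2', h3'⟩ s t hs ht hst
    refine ⟨?_, ?_, ?_⟩ <;> simp only [Prod.smul_mk, Prod.mk_add_mk, smul_eq_mul] at *
    · positivity
    · positivity
    · nlinarith
  | succ n ih =>
    obtain ⟨hA, hB, hC⟩ := approx_vertices n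
    exact isPreconnected_hutch ih hA hB hC

/-- By compactness, open sets separating `K` already contain, hence separate, some connected
approximation. -/
lemma isPreconnected_K : IsPreconnected K := by
  rw [isPreconnected_iff_subset_of_fully_disjoint_closed isClosed_K]
  intro u v hu hv huv hd
  obtain ⟨U, V, hU, hV, huU, hvV, hUV⟩ := normal_separation hu hv hd
  obtain ⟨n, hn⟩ := exists_subset_nhds_of_isCompact (V := approx) (U := U ∪ V)
    approx_antitone.directed_ge isCompact_approx fun x hx =>
      (hU.union hV).mem_nhds (union_subset_union huU hvV (huv hx))
  have hKn : K ⊆ approx n := iInter_subset _ n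
  rcases (isPreconnected_approx n).subset_or_subset hU hV hUV hn with h | h
  · exact Or.inl fun z hz => (huv hz).resolve_right fun hzv =>
      disjoint_left.1 hUV (h (hKn hz)) (hvV hzv)
  · exact Or.inr fun z hz => (huv hz).resolve_left fun hzu =>
      disjoint_left.1 hUV (huU hzu) (h (hKn hz))

lemma isConnected_K : IsConnected K := ⟨⟨_, A_mem_K⟩, isPreconnected_K⟩

/-! ### Contacts between pieces. -/

/-- The extreme points of the triangle. -/
def vertices : Set (ℝ × ℝ) := {(0, 0), (4, 0), (0, 4)}

lemma mem_vertices {z : ℝ × ℝ} :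
    z ∈ vertices ↔ z.1 = 0 ∧ z.2 = 0 ∨ z.1 = 4 ∧ z.2 = 0 ∨ z.1 = 0 ∧ z.2 = 4 := by
  simp [vertices, Prod.ext_iff]

lemma vertices_subset_K : vertices ⊆ K := by
  rintro z (rfl | rfl | rfl)
  exacts [A_mem_K, B_mem_K, C_mem_K]

/-- Two different pieces can only share vertices. -/
lemma mem_vertices_of_mem_T {j k : Fin 5} (hjk : j ≠ k) {z : ℝ × ℝ} (hj : Sinv j z ∈ T)
    (hk : Sinv k z ∈ T) : Sinv k z ∈ vertices := by
  rw [mem_vertices]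
  obtain ⟨h1, h2, h3⟩ := hj
  obtain ⟨g1, g2, g3⟩ := hk
  fin_cases j <;> fin_cases k <;> first | exact absurd rfl hjk | skip
  all_goals
    simp only [Fin.zero_eta, Fin.mk_one, Fin.reduceFinMk, Sinv_zero, Sinv_one, Sinv_two,
      Sinv_three, Sinv_four] at *
    first
    | (exfalso; linarith)
    | (left; constructor <;> linarith)
    | (right; left; constructor <;> linarith)
    | (right; right; constructor <;> linarith)

/-- Another piece can enter the triangle of piece `k` only at a vertex, and vertices belong to `K`.
So a piece is determined by its triangle alone. -/
lemma mem_S_image_of_mem_T {k : Fin 5} {z : ℝ × ℝ} (hz : z ∈ K) (hk : Sinv k z ∈ T) :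
    Sinv k z ∈ K := by
  obtain ⟨j, hj⟩ := exists_mem_S_image hz
  rw [mem_S_image] at hj
  by_cases hjk : j = k
  · exact hjk ▸ hj
  · exact vertices_subset_K (mem_vertices_of_mem_T hjk (K_subset_T hj) hk)

/-- A subset of `K` that is relatively open stays so under `S k`, unless `S k` moves one of its
points to another piece. -/
lemma isClosed_diff_S_image {W : Set (ℝ × ℝ)} {k : Fin 5} (hW : IsClosed (K \ W))
    (h : ∀ j ≠ k, ∀ z ∈ W, Sinv j (S k z) ∉ T) : IsClosed (K \ S k '' W) := by
  have heq : K \ S k '' W = (⋃ j ∈ {j : Fin 5 | j ≠ k}, S j '' K) ∪ S k '' (K \ W) := by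
    ext z
    constructor
    · rintro ⟨hz, hzW⟩
      obtain ⟨j, hj⟩ := exists_mem_S_image hz
      by_cases hjk : j = k
      · subst hjk
        rw [mem_S_image] at hj hzW
        exact Or.inr (mem_S_image.2 ⟨hj, hzW⟩)
      · exact Or.inl (mem_biUnion (by exact hjk) hj)
    · rintro (hz | ⟨y, ⟨hy, hyW⟩, rfl⟩)
      · obtain ⟨j, hjk, y, hy, rfl⟩ := mem_iUnion₂.1 hz
        refine ⟨S_mem_K j hy, ?_⟩
        rintro ⟨w, hw, hwy⟩
        refine h j hjk w hw ?_
        rw [hwy, Sinv_S]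
        exact K_subset_T hy
      · refine ⟨S_mem_K k hy, ?_⟩
        rintro ⟨w, hw, hwy⟩
        exact hyW (S_injective k hwy ▸ hw)
  rw [heq]
  refine (Set.Finite.isClosed_biUnion (toFinite _) fun j _ => ?_).union ?_
  · exact (isCompact_K.image (continuous_S j)).isClosed
  · exact ((isCompact_K.of_isClosed_subset hW sdiff_subset).image (continuous_S k)).isClosed

/-! ### Copies of the attractor along words. -/

lemma wordMap_cons (k : Fin 5) (w : List (Fin 5)) (z : ℝ × ℝ) :
    wordMap S (k :: w) z = S k (wordMap S w z) := rfl

lemma wordMap_append (v w : List (Fin 5)) (z : ℝ × ℝ) :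
    wordMap S (v ++ w) z = wordMap S v (wordMap S w z) := by
  induction v with
  | nil => rfl
  | cons k v ih => simp [wordMap_cons, ih]

lemma wordMap_mem_K (w : List (Fin 5)) {z : ℝ × ℝ} (hz : z ∈ K) : wordMap S w z ∈ K := by
  induction w with
  | nil => exact hz
  | cons k w ih => exact S_mem_K k ih

lemma wordMap_mem_T (w : List (Fin 5)) {z : ℝ × ℝ} (hz : z ∈ T) : wordMap S w z ∈ T := by
  induction w with
  | nil => exact hz
  | cons k w ih => exact S_mem_T k ih

/-- Maps along words are homotheties. -/
lemma exists_wordMap_eq (w : List (Fin 5)) :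
    ∃ r : ℝ, 0 < r ∧ ∃ b : ℝ × ℝ, ∀ z, wordMap S w z = r • z + b := by
  induction w with
  | nil => exact ⟨1, one_pos, 0, by simp [wordMap]⟩
  | cons k w ih =>
    obtain ⟨r, hr, b, hb⟩ := ih
    refine ⟨ratio k * r, mul_pos (ratio_pos k) hr, ratio k • b + shift k, fun z => ?_⟩
    rw [wordMap_cons, hb, S, smul_add, smul_smul, add_assoc]

lemma wordMap_injective (w : List (Fin 5)) : Function.Injective (wordMap S w) := by
  induction w with
  | nil => exact Function.injective_id
  | cons k w ih => exact (S_injective k).comp ih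

lemma mem_wordMap_image_of_mem_T (w : List (Fin 5)) {z : ℝ × ℝ} (hz : z ∈ T)
    (hK : wordMap S w z ∈ K) : z ∈ K := by
  induction w with
  | nil => exact hK
  | cons k w ih =>
    refine ih ?_
    have := mem_S_image_of_mem_T (k := k) hK (by
      rw [wordMap_cons, Sinv_S]; exact wordMap_mem_T w hz)
    rwa [wordMap_cons, Sinv_S] at this

lemma S_notMem_vertices {k : Fin 5} {z : ℝ × ℝ} (hz : z ∈ T) (hv : z ∉ vertices) :
    S k z ∉ vertices := by
  obtain ⟨h1, h2, h3⟩ := hz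
  contrapose! hv
  rw [mem_vertices] at *
  fin_cases k <;>
    simp only [Fin.zero_eta, Fin.mk_one, Fin.reduceFinMk, S_zero, S_one, S_two, S_three,
      S_four] at hv
  all_goals
    rcases hv with ⟨h, h'⟩ | ⟨h, h'⟩ | ⟨h, h'⟩
    all_goals first
    | (exfalso; linarith)
    | (left; constructor <;> linarith)
    | (right; left; constructor <;> linarith)
    | (right; right; constructor <;> linarith)

/-- The interior part of a piece is relatively open in `K`. -/
lemma isClosed_diff_wordMap_image (w : List (Fin 5)) :
    IsClosed (K \ wordMap S w '' (K \ vertices)) ∧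
      ∀ z ∈ K \ vertices, wordMap S w z ∉ vertices := by
  induction w with
  | nil =>
    refine ⟨?_, fun z hz => hz.2⟩
    have : K \ wordMap S [] '' (K \ vertices) = vertices := by
      simp [wordMap, inter_eq_right.2 vertices_subset_K]
    rw [this]
    exact (toFinite _).isClosed (s := {(0, 0), (4, 0), (0, 4)})
  | cons k w ih =>
    refine ⟨?_, fun z hz => S_notMem_vertices (wordMap_mem_T w (K_subset_T hz.1)) (ih.2 z hz)⟩
    have : wordMap S (k :: w) = S k ∘ wordMap S w := rfl
    rw [this, image_comp]
    refine isClosed_diff_S_image ih.1 ?_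
    rintro j hjk _ ⟨z, hz, rfl⟩ hT
    refine ih.2 z hz ?_
    have := mem_vertices_of_mem_T hjk hT (by
      rw [Sinv_S]; exact wordMap_mem_T w (K_subset_T hz.1))
    rwa [Sinv_S] at this

/-! ### Locating the piece of a point from its height. -/

lemma Sinv_three_mem_K {z : ℝ × ℝ} (hz : z ∈ K) (h2 : 2 ≤ z.2) (h3 : z.2 < 3) :
    Sinv 3 z ∈ K := by
  refine mem_S_image_of_mem_T hz ?_
  obtain ⟨k, hk⟩ := exists_mem_S_image hz
  obtain ⟨g1, g2, g3⟩ := K_subset_T (mem_S_image.1 hk)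
  simp only [T, Sinv_three, mem_ofPred_eq]
  fin_cases k <;> simp only [Fin.zero_eta, Fin.mk_one, Fin.reduceFinMk, Sinv_zero, Sinv_one,
    Sinv_two, Sinv_three, Sinv_four] at *
  all_goals first
    | (exfalso; linarith)
    | (refine ⟨?_, ?_, ?_⟩ <;> linarith)

lemma Sinv_four_mem_K {z : ℝ × ℝ} (hz : z ∈ K) (h3 : 3 ≤ z.2) : Sinv 4 z ∈ K := by
  refine mem_S_image_of_mem_T hz ?_
  obtain ⟨k, hk⟩ := exists_mem_S_image hz
  obtain ⟨g1, g2, g3⟩ := K_subset_T (mem_S_image.1 hk)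
  simp only [T, Sinv_four, mem_ofPred_eq]
  fin_cases k <;> simp only [Fin.zero_eta, Fin.mk_one, Fin.reduceFinMk, Sinv_zero, Sinv_one,
    Sinv_two, Sinv_three, Sinv_four] at *
  all_goals first
    | (exfalso; linarith)
    | (refine ⟨?_, ?_, ?_⟩ <;> linarith)

lemma one_le_fst {z : ℝ × ℝ} (hz : z ∈ K) (h1 : 1 < z.2) (h2 : z.2 < 2) : 1 ≤ z.1 := by
  obtain ⟨k, hk⟩ := exists_mem_S_image hz
  obtain ⟨g1, g2, g3⟩ := K_subset_T (mem_S_image.1 hk)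
  fin_cases k <;> simp only [Fin.zero_eta, Fin.mk_one, Fin.reduceFinMk, Sinv_zero, Sinv_one,
    Sinv_two, Sinv_three, Sinv_four] at * <;> linarith

/-- A connected subset of `K` without points common to two pieces lies in one piece. -/
lemma exists_subset_piece {X : Set (ℝ × ℝ)} (hX : IsPreconnected X) (hXK : X ⊆ K)
    (hJ : ∀ z ∈ X, ∀ j k, Sinv j z ∈ K → Sinv k z ∈ K → j = k) :
    ∃ k, ∀ z ∈ X, Sinv k z ∈ K := by
  rcases X.eq_empty_or_nonempty with rfl | ⟨z₀, hz₀⟩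
  · exact ⟨0, by simp⟩
  obtain ⟨k, hk⟩ := exists_mem_S_image (hXK hz₀)
  refine ⟨k, fun z hz => ?_⟩
  have hcl : ∀ j, IsClosed (Sinv j ⁻¹' K) := fun j => isClosed_K.preimage (continuous_Sinv j)
  by_contra hzk
  obtain ⟨y, hyX, hyk, hy⟩ := isPreconnected_closed_iff.1 hX (Sinv k ⁻¹' K)
    (⋃ j ∈ {j : Fin 5 | j ≠ k}, Sinv j ⁻¹' K) (hcl k)
    (Set.Finite.isClosed_biUnion (toFinite _) fun j _ => hcl j)
    (fun y hy => by
      obtain ⟨j, hj⟩ := exists_mem_S_image (hXK hy)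
      rw [mem_S_image] at hj
      by_cases hjk : j = k
      · exact Or.inl (hjk ▸ hj)
      · exact Or.inr (mem_biUnion (by exact hjk) hj))
    ⟨z₀, hz₀, mem_S_image.1 hk⟩
    ⟨z, hz, by
      obtain ⟨j, hj⟩ := exists_mem_S_image (hXK hz)
      rw [mem_S_image] at hj
      have hjk : j ≠ k := fun h => hzk (h ▸ hj)
      exact mem_biUnion (by exact hjk) hj⟩
  obtain ⟨j, hjk, hj⟩ := mem_iUnion₂.1 hy
  exact hjk (hJ y hyX j k hj hyk)

lemma piece_unique_of_low {z : ℝ × ℝ} (h0 : 0 < z.2) (h2 : z.2 < 2) {j k : Fin 5}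
    (hj : Sinv j z ∈ T) (hk : Sinv k z ∈ T) : j = k := by
  by_contra hjk
  obtain ⟨h1, h2, h3⟩ := hj
  obtain ⟨g1, g2, g3⟩ := hk
  fin_cases j <;> fin_cases k <;> first | exact absurd rfl hjk | skip
  all_goals
    simp only [Fin.zero_eta, Fin.mk_one, Fin.reduceFinMk, Sinv_zero, Sinv_one, Sinv_two,
      Sinv_three, Sinv_four] at *
    linarith

lemma piece_unique_of_two {z z' : ℝ × ℝ} (h0 : 0 < z.2) (h : z.2 = z'.2) (hlt : z.1 < z'.1)
    {j k : Fin 5} (hj : Sinv j z ∈ T) (hk : Sinv k z ∈ T) (hj' : Sinv j z' ∈ T)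
    (hk' : Sinv k z' ∈ T) : j = k := by
  by_contra hjk
  obtain ⟨h1, h2, h3⟩ := hj
  obtain ⟨g1, g2, g3⟩ := hk
  obtain ⟨h1', h2', h3'⟩ := hj'
  obtain ⟨g1', g2', g3'⟩ := hk'
  fin_cases j <;> fin_cases k <;> first | exact absurd rfl hjk | skip
  all_goals
    simp only [Fin.zero_eta, Fin.mk_one, Fin.reduceFinMk, Sinv_zero, Sinv_one, Sinv_two,
      Sinv_three, Sinv_four] at *
    linarith

/-! ### Segments that are not horizontal -/

section Slanted

variable {m Y : ℝ}

/-- Every segment with inverse slope `m` in `K` has vertical extent at most `Y`. -/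
def ExtentLE (m Y : ℝ) : Prop :=
  ∀ c s t, s ≤ t → (∀ y ∈ Icc s t, (m * y + c, y) ∈ K) → t - s ≤ Y

/-- `Sinv k` is a homothety: it keeps the inverse slope and divides heights by `ratio k`. -/
lemma ExtentLE.zoom (h : ExtentLE m Y) (k : Fin 5) {c s t : ℝ} (hst : s ≤ t)
    (hK : ∀ y ∈ Icc s t, Sinv k (m * y + c, y) ∈ K) : t - s ≤ ratio k * Y := by
  have hr := ratio_pos k
  have key := h ((ratio k)⁻¹ * (m * (shift k).2 + c - (shift k).1))
    ((ratio k)⁻¹ * (s - (shift k).2)) ((ratio k)⁻¹ * (t - (shift k).2))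
    (mul_le_mul_of_nonneg_left (by linarith) (inv_pos.2 hr).le) ?_
  · rw [← mul_sub, inv_mul_le_iff₀ hr] at key
    linarith
  · rintro y ⟨hy1, hy2⟩
    rw [inv_mul_le_iff₀ hr] at hy1
    rw [le_inv_mul_iff₀ hr] at hy2
    have := hK (ratio k * y + (shift k).2) ⟨by linarith, by linarith⟩
    convert this using 1
    ext
    · simp only [Sinv, Prod.smul_fst, Prod.fst_sub, smul_eq_mul]
      field_simp
      ring
    · simp only [Sinv, Prod.smul_snd, Prod.snd_sub, smul_eq_mul]
      field_simp
      ring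

lemma ExtentLE.low (h : ExtentLE m Y) (hY : 0 ≤ Y) {c s t : ℝ} (h0 : 0 ≤ s) (h2 : t ≤ 2)
    (hK : ∀ y ∈ Icc s t, (m * y + c, y) ∈ K) : t - s ≤ Y / 2 := by
  by_contra! hlt
  -- Trimming both ends by `ε` keeps the heights strictly between 0 and 2, where the pieces are
  -- disjoint, and loses only half of the excess.
  set ε := (t - s - Y / 2) / 4 with hε
  have hε0 : 0 < ε := by rw [hε]; linarith
  have hX : IsPreconnected ((fun y : ℝ => (m * y + c, y)) '' Icc (s + ε) (t - ε)) :=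
    isPreconnected_Icc.image _ (by fun_prop)
  obtain ⟨k, hk⟩ := exists_subset_piece hX
    (by rintro _ ⟨y, hy, rfl⟩; exact hK y ⟨by linarith [hy.1], by linarith [hy.2]⟩)
    (by
      rintro _ ⟨y, hy, rfl⟩ j k hj hk
      refine piece_unique_of_low ?_ ?_ (K_subset_T hj) (K_subset_T hk)
      · dsimp; linarith [hy.1]
      · dsimp; linarith [hy.2])
  have := h.zoom k (s := s + ε) (t := t - ε) (by linarith)
    (fun y hy => hk _ (mem_image_of_mem _ hy))
  have h3 := mul_le_mul_of_nonneg_right (ratio_le k) hY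
  linarith

lemma ExtentLE.middle (h : ExtentLE m Y) (hY : 0 ≤ Y) {c s t : ℝ} (h2 : 2 ≤ s) (h3 : t ≤ 3)
    (hK : ∀ y ∈ Icc s t, (m * y + c, y) ∈ K) : t - s ≤ Y / 4 := by
  by_contra! hlt
  set ε := (t - s - Y / 4) / 4 with hε
  have hε0 : 0 < ε := by rw [hε]; linarith
  have := h.zoom 3 (s := s) (t := t - ε) (by linarith) fun y hy => Sinv_three_mem_K
    (hK y ⟨hy.1, by linarith [hy.2]⟩) (h2.trans hy.1) (by dsimp; linarith [hy.2])
  have h4 : ratio 3 = 1 / 4 := by simp [ratio]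
  rw [h4] at this
  linarith

lemma ExtentLE.high (h : ExtentLE m Y) (hY : 0 ≤ Y) {c s t : ℝ} (h3 : 3 ≤ s)
    (hK : ∀ y ∈ Icc s t, (m * y + c, y) ∈ K) : t - s ≤ Y / 4 := by
  rcases le_or_gt s t with hst | hst
  · have := h.zoom 4 hst fun y hy => Sinv_four_mem_K (hK y hy) (h3.trans hy.1)
    have h4 : ratio 4 = 1 / 4 := by simp [ratio]
    rw [h4] at this
    linarith
  · linarith

/-- Cut at heights 2 and 3. The parts contribute at most `Y / 2`, `Y / 4`, `Y / 4`, so only a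
segment crossing both heights could break the bound, and such a segment does not exist. -/
lemma ExtentLE.improve (h : ExtentLE m Y) (hY : 0 ≤ Y) : ExtentLE m (3 / 4 * Y) := by
  intro c s t hst hK
  have hs := K_subset_T (hK s ⟨le_rfl, hst⟩)
  have ht := K_subset_T (hK t ⟨hst, le_rfl⟩)
  have hs0 : 0 ≤ s := hs.2.1
  rcases le_or_gt 2 s with h2 | h2
  · rcases le_or_gt t 3 with h3 | h3
    · linarith [h.middle hY h2 h3 hK]
    rcases le_or_gt 3 s with h3' | h3'
    · linarith [h.high hY h3' hK]
    · linarith [h.high hY le_rfl (fun y hy => hK y ⟨h3'.le.trans hy.1, hy.2⟩),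
        h.middle hY h2 le_rfl (fun y hy => hK y ⟨hy.1, hy.2.trans h3.le⟩)]
  rcases le_or_gt t 2 with h2' | h2'
  · linarith [h.low hY hs0 h2' hK]
  rcases le_or_gt t 3 with h3 | h3
  · linarith [h.low hY hs0 le_rfl (fun y hy => hK y ⟨hy.1, hy.2.trans h2'.le⟩),
      h.middle hY le_rfl h3 (fun y hy => hK y ⟨h2.le.trans hy.1, hy.2⟩)]
  exfalso
  -- The midpoint of `max s 1` and 2, so `3 / 2 ≤ y₁ < 2`. There the segment has abscissa at least
  -- 1, while at height `5 / 2` it is at most `1 / 2`, so it leans left.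
  set y₁ := max s 1 / 2 + 1 with hy₁
  have e1 : s ≤ max s 1 := le_max_left _ _
  have e2 : 1 ≤ max s 1 := le_max_right _ _
  have e3 : max s 1 < 2 := max_lt h2 (by norm_num)
  have k1 := one_le_fst (hK y₁ ⟨by linarith, by linarith⟩) (by dsimp; linarith)
    (by dsimp; linarith)
  have k2 := (K_subset_T (Sinv_three_mem_K (hK (5 / 2) ⟨by linarith, by linarith⟩)
    (by norm_num) (by norm_num))).2.2
  have ht4 : t ≤ 4 := by have := ht.2.2; have := ht.1; dsimp at *; linarith
  -- At this height the abscissa is at most `(t - 3) / 4`. With `m ≤ -1 / 3` it would be negative at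
  -- height `t`.
  have k3 := (K_subset_T (Sinv_three_mem_K (hK (3 - (t - 3) / 4) ⟨by linarith, by linarith⟩)
    (by dsimp; linarith) (by dsimp; linarith))).2.2
  have k4 := ht.1
  simp only [Sinv_three] at *
  have hm : m ≤ -1 / 3 := by
    by_contra! hm
    nlinarith
  nlinarith

lemma extentLE_zero (m : ℝ) : ExtentLE m 0 := by
  have hn : ∀ n : ℕ, ExtentLE m ((3 / 4) ^ n * 4) := by
    intro n
    induction n with
    | zero =>
      intro c s t hst hK
      have hs := (K_subset_T (hK s ⟨le_rfl, hst⟩)).2.1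
      obtain ⟨h1, -, h2⟩ := K_subset_T (hK t ⟨hst, le_rfl⟩)
      dsimp at *
      linarith
    | succ n ih =>
      have := ih.improve (by positivity)
      rwa [← mul_assoc, ← pow_succ'] at this
  intro c s t hst hK
  have hlim : Tendsto (fun n : ℕ => ((3 : ℝ) / 4) ^ n * 4) atTop (𝓝 (0 * 4)) :=
    (tendsto_pow_atTop_nhds_zero_of_lt_one (by norm_num) (by norm_num)).mul_const 4
  rw [zero_mul] at hlim
  exact ge_of_tendsto' hlim fun n => hn n c s t hst hK

end Slanted

lemma snd_eq_of_segment_subset {p q : ℝ × ℝ} (h : segment ℝ p q ⊆ K) : p.2 = q.2 := by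
  wlog hlt : p.2 ≤ q.2 generalizing p q
  · exact (this (segment_symm ℝ p q ▸ h) (le_of_not_ge hlt)).symm
  by_contra hne
  have hlt' : 0 < q.2 - p.2 := sub_pos.2 (lt_of_le_of_ne hlt hne)
  have := extentLE_zero ((q.1 - p.1) / (q.2 - p.2)) (p.1 - (q.1 - p.1) / (q.2 - p.2) * p.2)
    p.2 q.2 hlt ?_
  · linarith
  · rintro y ⟨hy1, hy2⟩
    refine h ⟨(q.2 - y) / (q.2 - p.2), (y - p.2) / (q.2 - p.2), by apply div_nonneg <;> linarith,
      by apply div_nonneg <;> linarith, by field_simp; ring, ?_⟩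
    ext
    · simp only [Prod.fst_add, Prod.smul_fst, smul_eq_mul]
      field_simp
      ring
    · simp only [Prod.snd_add, Prod.smul_snd, smul_eq_mul]
      field_simp
      ring

/-! ### Maximal horizontal segments. -/

/-- `[p, q]` is a maximal line segment of `X`. -/
def MaxSegment (X : Set (ℝ × ℝ)) (p q : ℝ × ℝ) : Prop :=
  segment ℝ p q ⊆ X ∧ ∀ p' q', segment ℝ p' q' ⊆ X → segment ℝ p q ⊆ segment ℝ p' q' →
    segment ℝ p' q' = segment ℝ p q

lemma image_S_segment (k : Fin 5) (p q : ℝ × ℝ) :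
    S k '' segment ℝ p q = segment ℝ (S k p) (S k q) :=
  image_segment ℝ (ratio k • AffineMap.id ℝ (ℝ × ℝ) + AffineMap.const ℝ _ (shift k)) p q

lemma image_Sinv_segment (k : Fin 5) (p q : ℝ × ℝ) :
    Sinv k '' segment ℝ p q = segment ℝ (Sinv k p) (Sinv k q) := by
  conv_lhs => rw [← S_Sinv k p, ← S_Sinv k q, ← image_S_segment, image_image]
  simp

lemma snd_eq_of_mem_segment {p q z : ℝ × ℝ} (h : p.2 = q.2) (hz : z ∈ segment ℝ p q) :
    z.2 = p.2 := by
  obtain ⟨s, t, -, -, hst, rfl⟩ := hz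
  simp only [Prod.snd_add, Prod.smul_snd, smul_eq_mul, ← h, ← add_mul, hst, one_mul]

/-- A non-degenerate horizontal segment of `K` above the base lies in one piece. -/
lemma exists_piece_of_segment {p q : ℝ × ℝ} (h : segment ℝ p q ⊆ K) (h0 : 0 < p.2) :
    ∃ k, segment ℝ (Sinv k p) (Sinv k q) ⊆ K := by
  have hpq := snd_eq_of_segment_subset h
  have key : ∃ k, ∀ z ∈ segment ℝ p q, Sinv k z ∈ K := by
    rcases le_or_gt 3 p.2 with h3 | h3
    · refine ⟨4, fun z hz => Sinv_four_mem_K (h hz) ?_⟩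
      rwa [snd_eq_of_mem_segment hpq hz]
    rcases le_or_gt 2 p.2 with h2 | h2
    · refine ⟨3, fun z hz => Sinv_three_mem_K (h hz) ?_ ?_⟩ <;>
        rwa [snd_eq_of_mem_segment hpq hz]
    refine exists_subset_piece (convex_segment p q).isPreconnected h ?_
    intro z hz j k hj hk
    have := snd_eq_of_mem_segment hpq hz
    exact piece_unique_of_low (this ▸ h0) (this ▸ h2) (K_subset_T hj) (K_subset_T hk)
  obtain ⟨k, hk⟩ := key
  refine ⟨k, ?_⟩
  rw [← image_Sinv_segment]
  rintro _ ⟨z, hz, rfl⟩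
  exact hk z hz

lemma segment_subset_base {p q : ℝ × ℝ} (hp : p ∈ T) (hq : q ∈ T) (hp0 : p.2 = 0)
    (hq0 : q.2 = 0) : segment ℝ p q ⊆ segment ℝ (0, 0) (4, 0) := by
  have key : ∀ z ∈ T, z.2 = 0 → z ∈ segment ℝ ((0, 0) : ℝ × ℝ) (4, 0) := by
    rintro ⟨x, y⟩ ⟨h1, -, h3⟩ (rfl : y = 0)
    simp only [add_zero] at h1 h3
    refine ⟨1 - x / 4, x / 4, by linarith, by linarith, by ring, ?_⟩
    ext <;> simp
  exact (convex_segment _ _).segment_subset (key p hp hp0) (key q hq hq0)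

lemma base_segment_subset : segment ℝ ((0, 0) : ℝ × ℝ) (4, 0) ⊆ K := by
  rintro _ ⟨s, t, hs, ht, hst, rfl⟩
  simpa using base_mem_K (x := t * 4) (by linarith) (by linarith)

lemma maxSegment_base : MaxSegment K (0, 0) (4, 0) := by
  refine ⟨base_segment_subset, fun p' q' h hsub => Subset.antisymm ?_ hsub⟩
  have h2 := snd_eq_of_segment_subset h
  have h0 := snd_eq_of_mem_segment h2 (hsub (left_mem_segment ℝ _ _))
  exact segment_subset_base (K_subset_T (h (left_mem_segment ℝ _ _)))
    (K_subset_T (h (right_mem_segment ℝ _ _))) h0.symm (h2 ▸ h0.symm)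

/-- Above the base, a larger segment would lie in a single piece. Sharing two points with piece `k`,
it lies in that piece and pulls back. On the base this fails, since three pieces join there. -/
lemma MaxSegment.image {p q : ℝ × ℝ} (h : MaxSegment K p q) (hlt : p.1 < q.1) (k : Fin 5)
    (h0 : 0 < (S k p).2) : MaxSegment K (S k p) (S k q) := by
  have hpq := snd_eq_of_segment_subset h.1
  have hp := h.1 (left_mem_segment ℝ p q)
  have hq := h.1 (right_mem_segment ℝ p q)
  refine ⟨?_, fun p' q' h' hsub => ?_⟩
  · rw [← image_S_segment]
    rintro _ ⟨z, hz, rfl⟩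
    exact S_mem_K k (h.1 hz)
  have h2 := snd_eq_of_segment_subset h'
  have hl := hsub (left_mem_segment ℝ _ _)
  have hr := hsub (right_mem_segment ℝ _ _)
  obtain ⟨j, hj⟩ := exists_piece_of_segment h' (by rwa [← snd_eq_of_mem_segment h2 hl])
  have hjT : ∀ z ∈ segment ℝ p' q', Sinv j z ∈ T := fun z hz =>
    K_subset_T (hj (image_Sinv_segment j p' q' ▸ mem_image_of_mem _ hz))
  have hjk : j = k := by
    refine piece_unique_of_two h0 ?_ ?_ (hjT _ hl) (K_subset_T (by simpa using hp)) (hjT _ hr)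
      (K_subset_T (by simpa using hq))
    · simp [S, hpq]
    · simpa [S] using mul_lt_mul_of_pos_left hlt (ratio_pos k)
  subst hjk
  have := h.2 _ _ hj (by
    rw [← image_Sinv_segment]
    intro z hz
    refine ⟨S j z, hsub ?_, Sinv_S j z⟩
    rw [← image_S_segment]
    exact mem_image_of_mem _ hz)
  rw [← image_S_segment, ← this, image_S_segment, S_Sinv, S_Sinv]

/-- Every non-degenerate segment of `K` lies in a maximal one, which is the image of the base
under a map along a word. -/
lemma exists_maxSegment_aux (n : ℕ) {p q : ℝ × ℝ} (hlt : 4 / 2 ^ n ≤ q.1 - p.1)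
    (h : segment ℝ p q ⊆ K) : ∃ w : List (Fin 5), ∃ m : ℕ,
      MaxSegment K (wordMap S w (0, 0)) (wordMap S w (4, 0)) ∧
      segment ℝ p q ⊆ segment ℝ (wordMap S w (0, 0)) (wordMap S w (4, 0)) ∧
      (wordMap S w (4, 0)).1 - (wordMap S w (0, 0)).1 = 4 / 2 ^ m := by
  have hpq := snd_eq_of_segment_subset h
  have hp := K_subset_T (h (left_mem_segment ℝ p q))
  have hq := K_subset_T (h (right_mem_segment ℝ p q))
  rcases hp.2.1.eq_or_lt with h0 | h0
  · exact ⟨[], 0, maxSegment_base, segment_subset_base hp hq h0.symm (hpq ▸ h0.symm),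
      by norm_num [wordMap]⟩
  -- Each pull-back at least doubles the length, and a segment above the base is shorter than 4, so
  -- the base is reached before the exponent runs out.
  induction n generalizing p q with
  | zero =>
    have h1 := hp.1
    have h2 := hq.2.2
    norm_num at hlt
    linarith
  | succ n ih =>
    obtain ⟨k, hk⟩ := exists_piece_of_segment h h0
    have hpk := K_subset_T (hk (left_mem_segment ℝ _ _))
    have hqk := K_subset_T (hk (right_mem_segment ℝ _ _))
    have hpq' := snd_eq_of_segment_subset hk
    have hlen : 4 / 2 ^ n ≤ (Sinv k q).1 - (Sinv k p).1 := by
      have hr := ratio_pos k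
      have : (Sinv k q).1 - (Sinv k p).1 = (ratio k)⁻¹ * (q.1 - p.1) := by
        simp [Sinv]; ring
      rw [this, le_inv_mul_iff₀ hr]
      have h4 : (4 : ℝ) / 2 ^ n = 2 * (4 / 2 ^ (n + 1)) := by field_simp; ring
      have h5 : 0 < (4 : ℝ) / 2 ^ (n + 1) := by positivity
      rw [h4]
      nlinarith [ratio_le k]
    have main : ∃ w : List (Fin 5), ∃ m : ℕ,
      MaxSegment K (wordMap S w (0, 0)) (wordMap S w (4, 0)) ∧
      segment ℝ (Sinv k p) (Sinv k q) ⊆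
        segment ℝ (wordMap S w (0, 0)) (wordMap S w (4, 0)) ∧
      (wordMap S w (4, 0)).1 - (wordMap S w (0, 0)).1 = 4 / 2 ^ m := by
      rcases hpk.2.1.eq_or_lt with h0' | h0'
      · exact ⟨[], 0, maxSegment_base, segment_subset_base hpk hqk h0'.symm (hpq' ▸ h0'.symm),
          by norm_num [wordMap]⟩
      · exact ih hlen hk hpq' hpk hqk h0'
    obtain ⟨w, m, hw, hsub, hm⟩ := main
    have hsub' : segment ℝ p q ⊆
        segment ℝ (wordMap S (k :: w) (0, 0)) (wordMap S (k :: w) (4, 0)) := by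
      rw [wordMap_cons, wordMap_cons, ← image_S_segment, ← S_Sinv k p, ← S_Sinv k q,
        ← image_S_segment]
      exact image_mono hsub
    have hlt' : (wordMap S w (0, 0)).1 < (wordMap S w (4, 0)).1 := by
      have : 0 < (4 : ℝ) / 2 ^ m := by positivity
      linarith
    have hhor := snd_eq_of_segment_subset hw.1
    have hpos : 0 < (S k (wordMap S w (0, 0))).2 := by
      rw [← wordMap_cons, ← snd_eq_of_mem_segment _ (hsub' (left_mem_segment ℝ p q))]
      · exact h0
      · simp [wordMap_cons, S, hhor]
    obtain ⟨i, hi⟩ : ∃ i : ℕ, ratio k = 1 / 2 ^ i := by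
      fin_cases k
      exacts [⟨2, by norm_num [ratio]⟩, ⟨1, by norm_num [ratio]⟩, ⟨2, by norm_num [ratio]⟩,
        ⟨2, by norm_num [ratio]⟩, ⟨2, by norm_num [ratio]⟩]
    refine ⟨k :: w, i + m, hw.image hlt' k hpos, hsub', ?_⟩
    rw [wordMap_cons, wordMap_cons, ← Prod.fst_sub, S_sub, Prod.smul_fst, Prod.fst_sub, hm, hi,
      smul_eq_mul, pow_add]
    field_simp

lemma exists_maxSegment {p q : ℝ × ℝ} (hne : p ≠ q) (h : segment ℝ p q ⊆ K) :
    ∃ w : List (Fin 5), ∃ m : ℕ,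
      MaxSegment K (wordMap S w (0, 0)) (wordMap S w (4, 0)) ∧
      segment ℝ p q ⊆ segment ℝ (wordMap S w (0, 0)) (wordMap S w (4, 0)) ∧
      (wordMap S w (4, 0)).1 - (wordMap S w (0, 0)).1 = 4 / 2 ^ m := by
  have hpq := snd_eq_of_segment_subset h
  have hne1 : p.1 ≠ q.1 := fun h1 => hne (Prod.ext h1 hpq)
  wlog hlt : p.1 < q.1 generalizing p q
  · rw [segment_symm ℝ p q]
    exact this hne.symm (segment_symm ℝ p q ▸ h) hpq.symm hne1.symm
      (lt_of_le_of_ne (le_of_not_gt hlt) hne1.symm)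
  obtain ⟨n, hn⟩ := exists_pow_lt_of_lt_one (y := (1 / 2 : ℝ)) (x := (q.1 - p.1) / 4)
    (by linarith) (by norm_num)
  refine exists_maxSegment_aux n ?_ h
  rw [one_div_pow] at hn
  rw [div_eq_mul_one_div]
  linarith

lemma dist_le_of_mem_T {z w : ℝ × ℝ} (hz : z ∈ T) (hw : w ∈ T) : dist z w ≤ 4 := by
  obtain ⟨h1, h2, h3⟩ := hz
  obtain ⟨g1, g2, g3⟩ := hw
  rw [Prod.dist_eq, Real.dist_eq, Real.dist_eq, max_le_iff, abs_le, abs_le]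
  refine ⟨⟨?_, ?_⟩, ?_, ?_⟩ <;> linarith

/-! ### Local connectedness -/

/-- Unite small connected neighbourhoods of `z` taken inside each piece through `z`. They all
contain `z`, and the closed pieces missing `z` do not matter near it. Each level of pieces halves
the radius. -/
lemma exists_small_connected_nhd (n : ℕ) {z : ℝ × ℝ} (hz : z ∈ K) :
    ∃ N ⊆ K, N ∈ 𝓝[K] z ∧ z ∈ N ∧ IsPreconnected N ∧ N ⊆ Metric.closedBall z (4 / 2 ^ n) := by
  induction n generalizing z with
  | zero =>
    refine ⟨K, Subset.rfl, self_mem_nhdsWithin, hz, isPreconnected_K, fun y hy => ?_⟩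
    simpa using dist_le_of_mem_T (K_subset_T hy) (K_subset_T hz)
  | succ n ih =>
    have key : ∀ k, ∃ N ⊆ K, N ∈ 𝓝[S k '' K] z ∧ (N.Nonempty → z ∈ N) ∧ IsPreconnected N ∧
        N ⊆ Metric.closedBall z (4 / 2 ^ (n + 1)) := by
      intro k
      by_cases hk : z ∈ S k '' K
      · rw [mem_S_image] at hk
        obtain ⟨N, hNK, hN, hzN, hNc, hNb⟩ := ih hk
        refine ⟨S k '' N, ?_, ?_, fun _ => mem_S_image.2 hzN,
          hNc.image _ (continuous_S k).continuousOn, ?_⟩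
        · rintro _ ⟨y, hy, rfl⟩
          exact S_mem_K k (hNK hy)
        · have ht : Tendsto (Sinv k) (𝓝[S k '' K] z) (𝓝[K] (Sinv k z)) :=
            tendsto_nhdsWithin_of_tendsto_nhds_of_eventually_within _
              ((continuous_Sinv k).tendsto z |>.mono_left nhdsWithin_le_nhds)
              (by filter_upwards [self_mem_nhdsWithin] with y hy using mem_S_image.1 hy)
          filter_upwards [ht hN] with y hy using mem_S_image.2 hy
        · rintro _ ⟨y, hy, rfl⟩
          have h1 : dist y (Sinv k z) ≤ 4 / 2 ^ n := hNb hy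
          have h2 := dist_S k y (Sinv k z)
          rw [S_Sinv] at h2
          rw [Metric.mem_closedBall, h2]
          calc ratio k * dist y (Sinv k z) ≤ 1 / 2 * (4 / 2 ^ n) := by
                gcongr
                exact ratio_le k
            _ = 4 / 2 ^ (n + 1) := by rw [pow_succ]; field_simp
      · refine ⟨∅, empty_subset _, ?_, by simp, isPreconnected_empty, empty_subset _⟩
        have hcl : IsClosed (S k '' K) := (isCompact_K.image (continuous_S k)).isClosed
        have : 𝓝[S k '' K] z = ⊥ := by
          rw [← not_neBot, ← mem_closure_iff_nhdsWithin_neBot, hcl.closure_eq]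
          exact hk
        simp [this]
    choose N hNK hN hzN hNc hNb using key
    obtain ⟨k₀, hk₀⟩ := exists_mem_S_image hz
    have hz₀ : z ∈ N k₀ := mem_of_mem_nhdsWithin hk₀ (hN k₀)
    refine ⟨⋃ k, N k, iUnion_subset hNK, ?_, mem_iUnion.2 ⟨k₀, hz₀⟩, ?_, iUnion_subset hNb⟩
    · rw [K_eq, nhdsWithin_iUnion, mem_iSup]
      exact fun k => mem_of_superset (hN k) (subset_iUnion N k)
    · refine isPreconnected_of_forall z fun y hy => ?_
      obtain ⟨k, hk⟩ := mem_iUnion.1 hy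
      exact ⟨N k, subset_iUnion N k, hzN k ⟨y, hk⟩, hk, hNc k⟩

lemma locallyConnectedSpace_K : LocallyConnectedSpace K := by
  rw [locallyConnectedSpace_iff_connected_subsets]
  rintro ⟨z, hz⟩ U hU
  rw [nhds_subtype, mem_comap] at hU
  obtain ⟨V, hV, hVU⟩ := hU
  obtain ⟨ε, hε, hεV⟩ := Metric.nhds_basis_closedBall.mem_iff.1 hV
  obtain ⟨n, hn⟩ := exists_pow_lt_of_lt_one (y := (1 / 2 : ℝ)) (x := ε / 4)
    (by linarith) (by norm_num)
  obtain ⟨N, hNK, hN, -, hNc, hNb⟩ := exists_small_connected_nhd n hz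
  refine ⟨Subtype.val ⁻¹' N, ?_, ?_, ?_⟩
  · rw [mem_nhds_subtype_iff_nhdsWithin, Subtype.image_preimage_coe, inter_comm]
    exact inter_mem hN self_mem_nhdsWithin
  · rw [← Topology.IsInducing.subtypeVal.isPreconnected_image, Subtype.image_preimage_coe,
      inter_eq_right.2 hNK]
    exact hNc
  · intro y hy
    refine hVU (hεV (Metric.closedBall_subset_closedBall ?_ (hNb hy)))
    rw [one_div_pow] at hn
    rw [div_eq_mul_one_div]
    linarith

/-! ### Simple closed curves -/

/-- The exponential, rotated so that the angle `π` falls on `c`, maps an open interval onto the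
complement. -/
lemma isPreconnected_circle_compl_singleton (c : Circle) : IsPreconnected ({c}ᶜ : Set Circle) := by
  have hpi : Circle.exp Real.pi * Circle.exp Real.pi = 1 := by
    rw [← Circle.exp_add, ← two_mul, Circle.exp_two_pi]
  have h : ({c}ᶜ : Set Circle) = (fun θ : ℝ => c * Circle.exp Real.pi * Circle.exp θ) ''
      Ioo (-Real.pi) Real.pi := by
    ext z
    simp only [mem_compl_iff, mem_singleton_iff, mem_image, mem_Ioo]
    constructor
    · intro hz
      set u := (c * Circle.exp Real.pi)⁻¹ * z with hu
      have hzu : z = c * Circle.exp Real.pi * u := by rw [hu, mul_inv_cancel_left]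
      have harg : Circle.exp (Complex.arg u) = u := Circle.exp_arg u
      refine ⟨Complex.arg u, ⟨Complex.neg_pi_lt_arg _, ?_⟩, by rw [harg, hzu]⟩
      refine lt_of_le_of_ne (Complex.arg_le_pi _) fun h => hz ?_
      rw [hzu, ← harg, h, mul_assoc, hpi, mul_one]
    · rintro ⟨θ, ⟨h1, h2⟩, rfl⟩ hc
      have h3 : Circle.exp Real.pi * Circle.exp θ = Circle.exp Real.pi * Circle.exp Real.pi := by
        rw [hpi]
        rwa [mul_assoc, mul_eq_left] at hc
      have h4 := mul_left_cancel h3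
      have h5 := congrArg (fun u : Circle => Complex.arg u) h4
      rw [Circle.arg_exp h1 h2.le, Circle.arg_exp (by linarith [Real.pi_pos]) le_rfl] at h5
      exact h2.ne h5
  rw [h]
  exact isPreconnected_Ioo.image _ (by fun_prop)

/-- A simple closed curve cannot pass through a cut point. -/
lemma circle_subset_or_subset {X : Type*} [TopologicalSpace X] {γ : Circle → X}
    (hγ : Continuous γ) (hinj : Function.Injective γ) {P Q : Set X} (hP : IsClosed P)
    (hQ : IsClosed Q) (hPQ : ∀ t, γ t ∈ P ∪ Q) (h : (P ∩ Q).Subsingleton) :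
    (∀ t, γ t ∈ P) ∨ ∀ t, γ t ∈ Q := by
  by_contra! hcon
  obtain ⟨⟨s, hs⟩, t, ht⟩ := hcon
  obtain ⟨Y, hY, hsY, htY, hYJ⟩ : ∃ Y : Set Circle, IsPreconnected Y ∧ s ∈ Y ∧ t ∈ Y ∧
      ∀ u ∈ Y, γ u ∉ P ∩ Q := by
    by_cases hc : ∃ c, γ c ∈ P ∩ Q
    · obtain ⟨c, hc⟩ := hc
      refine ⟨{c}ᶜ, isPreconnected_circle_compl_singleton c, ?_, ?_, ?_⟩
      · rintro rfl
        exact hs hc.1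
      · rintro rfl
        exact ht hc.2
      · exact fun u hu hγu => hu (hinj (h hγu hc))
    · push Not at hc
      exact ⟨univ, isPreconnected_univ, mem_univ _, mem_univ _, fun u _ => hc u⟩
  obtain ⟨u, hu, hu1, hu2⟩ := isPreconnected_closed_iff.1 hY (γ ⁻¹' P) (γ ⁻¹' Q)
    (hP.preimage hγ) (hQ.preimage hγ) (fun u _ => hPQ u)
    ⟨t, htY, (hPQ t).resolve_right ht⟩ ⟨s, hsY, (hPQ s).resolve_left hs⟩
  exact hYJ u hu ⟨hu1, hu2⟩

/-- The curve lies on one side of each of the four contact points `(1, 0)`, `(3, 0)`, `(0, 3)`, `(1,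
2)`. These four choices single out a piece. -/
lemma circle_subset_piece {γ : Circle → ℝ × ℝ} (hγ : Continuous γ)
    (hinj : Function.Injective γ) (hK : ∀ t, γ t ∈ K) : ∃ k, ∀ t, Sinv k (γ t) ∈ K := by
  have hcl : ∀ j, IsClosed (Sinv j ⁻¹' K) := fun j => isClosed_K.preimage (continuous_Sinv j)
  have hcov : ∀ t, ∃ k, γ t ∈ Sinv k ⁻¹' K := fun t =>
    (exists_mem_S_image (hK t)).imp fun k hk => mem_S_image.1 hk
  simp only [exists_fin5] at hcov
  have tri : ∀ k, Sinv k ⁻¹' K ⊆ {z | Sinv k z ∈ T} := fun k z hz => K_subset_T hz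
  have t0 := tri 0
  have t1 := tri 1
  have t2 := tri 2
  have t3 := tri 3
  have t4 := tri 4
  simp only [T, Sinv_zero, Sinv_one, Sinv_two, Sinv_three, Sinv_four, subset_def,
    mem_ofPred_eq] at t0 t1 t2 t3 t4
  have cut : ∀ (P Q : Set (ℝ × ℝ)) (a : ℝ × ℝ), IsClosed P → IsClosed Q →
      (∀ z, (∃ k, z ∈ Sinv k ⁻¹' K) → z ∈ P ∨ z ∈ Q) → (∀ z ∈ P, z ∈ Q → z = a) →
      (∀ t, γ t ∈ P) ∨ ∀ t, γ t ∈ Q := fun P Q a hP hQ hPQ h =>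
    circle_subset_or_subset hγ hinj hP hQ (fun t => hPQ _ (exists_fin5.2 (hcov t)))
      fun x hx y hy => (h x hx.1 hx.2).trans (h y hy.1 hy.2).symm
  rcases cut _ (Sinv 1 ⁻¹' K ∪ Sinv 2 ⁻¹' K ∪ Sinv 3 ⁻¹' K ∪ Sinv 4 ⁻¹' K) (1, 0) (hcl 0)
    ((((hcl 1).union (hcl 2)).union (hcl 3)).union (hcl 4))
    (fun z => by rw [exists_fin5]; simp only [mem_union]; tauto)
    (by
      rintro z h0 (((h | h) | h) | h) <;> have h' := t0 z h0 <;> first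
        | have h'' := t1 z h; ext <;> dsimp <;> linarith
        | have h'' := t2 z h; ext <;> dsimp <;> linarith
        | have h'' := t3 z h; ext <;> dsimp <;> linarith
        | have h'' := t4 z h; ext <;> dsimp <;> linarith) with h0 | h0
  · exact ⟨0, h0⟩
  rcases cut _ (Sinv 0 ⁻¹' K ∪ Sinv 1 ⁻¹' K ∪ Sinv 3 ⁻¹' K ∪ Sinv 4 ⁻¹' K) (3, 0) (hcl 2)
    ((((hcl 0).union (hcl 1)).union (hcl 3)).union (hcl 4))
    (fun z => by rw [exists_fin5]; simp only [mem_union]; tauto)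
    (by
      rintro z h0 (((h | h) | h) | h) <;> have h' := t2 z h0 <;> first
        | have h'' := t0 z h; ext <;> dsimp <;> linarith
        | have h'' := t1 z h; ext <;> dsimp <;> linarith
        | have h'' := t3 z h; ext <;> dsimp <;> linarith
        | have h'' := t4 z h; ext <;> dsimp <;> linarith) with h2 | h2
  · exact ⟨2, h2⟩
  rcases cut _ (Sinv 0 ⁻¹' K ∪ Sinv 1 ⁻¹' K ∪ Sinv 2 ⁻¹' K ∪ Sinv 3 ⁻¹' K) (0, 3) (hcl 4)
    ((((hcl 0).union (hcl 1)).union (hcl 2)).union (hcl 3))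
    (fun z => by rw [exists_fin5]; simp only [mem_union]; tauto)
    (by
      rintro z h0 (((h | h) | h) | h) <;> have h' := t4 z h0 <;> first
        | have h'' := t0 z h; ext <;> dsimp <;> linarith
        | have h'' := t1 z h; ext <;> dsimp <;> linarith
        | have h'' := t2 z h; ext <;> dsimp <;> linarith
        | have h'' := t3 z h; ext <;> dsimp <;> linarith) with h4 | h4
  · exact ⟨4, h4⟩
  rcases cut (Sinv 3 ⁻¹' K ∪ Sinv 4 ⁻¹' K) (Sinv 0 ⁻¹' K ∪ Sinv 1 ⁻¹' K ∪ Sinv 2 ⁻¹' K) (1, 2)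
    ((hcl 3).union (hcl 4)) (((hcl 0).union (hcl 1)).union (hcl 2))
    (fun z => by rw [exists_fin5]; simp only [mem_union]; tauto)
    (by
      rintro z (h | h) ((h' | h') | h') <;> first
        | have g := t3 z h; have g' := t0 z h'; ext <;> dsimp <;> linarith
        | have g := t3 z h; have g' := t1 z h'; ext <;> dsimp <;> linarith
        | have g := t3 z h; have g' := t2 z h'; ext <;> dsimp <;> linarith
        | have g := t4 z h; have g' := t0 z h'; ext <;> dsimp <;> linarith
        | have g := t4 z h; have g' := t1 z h'; ext <;> dsimp <;> linarith
        | have g := t4 z h; have g' := t2 z h'; ext <;> dsimp <;> linarith) with h3 | h3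
  · refine ⟨3, fun t => ?_⟩
    rcases h3 t with h | h
    · exact h
    have g := t4 _ h
    rcases h4 t with ((h' | h') | h') | h'
    · have g' := t0 _ h'; linarith
    · have g' := t1 _ h'; linarith
    · have g' := t2 _ h'; linarith
    · exact h'
  · refine ⟨1, fun t => ?_⟩
    rcases h3 t with (h | h) | h
    · have g := t0 _ h
      rcases h0 t with ((h' | h') | h') | h'
      · exact h'
      · have g' := t2 _ h'; linarith
      · have g' := t3 _ h'; linarith
      · have g' := t4 _ h'; linarith
    · exact h
    · have g := t2 _ h
      rcases h2 t with ((h' | h') | h') | h'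
      · have g' := t0 _ h'; linarith
      · exact h'
      · have g' := t3 _ h'; linarith
      · have g' := t4 _ h'; linarith

lemma dist_circle_le (n : ℕ) {γ : Circle → ℝ × ℝ} (hγ : Continuous γ)
    (hinj : Function.Injective γ) (hK : ∀ t, γ t ∈ K) (s t : Circle) :
    dist (γ s) (γ t) ≤ 4 / 2 ^ n := by
  induction n generalizing γ with
  | zero => simpa using dist_le_of_mem_T (K_subset_T (hK s)) (K_subset_T (hK t))
  | succ n ih =>
    obtain ⟨k, hk⟩ := circle_subset_piece hγ hinj hK
    have h := ih ((continuous_Sinv k).comp hγ)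
      ((Function.LeftInverse.injective (S_Sinv k)).comp hinj) hk
    have h2 := dist_S k (Sinv k (γ s)) (Sinv k (γ t))
    rw [S_Sinv, S_Sinv] at h2
    rw [h2]
    calc ratio k * dist (Sinv k (γ s)) (Sinv k (γ t)) ≤ 1 / 2 * (4 / 2 ^ n) := by
          gcongr
          exacts [ratio_le k, h]
      _ = 4 / 2 ^ (n + 1) := by rw [pow_succ]; field_simp

lemma no_circle_in_K {γ : Circle → ℝ × ℝ} (hγ : Continuous γ)
    (hinj : Function.Injective γ) (hK : ∀ t, γ t ∈ K) : False := by
  have h0 : dist (γ 1) (γ (Circle.exp Real.pi)) ≤ 0 := by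
    have hlim : Tendsto (fun n : ℕ => 4 * ((1 : ℝ) / 2) ^ n) atTop (𝓝 (4 * 0)) :=
      (tendsto_pow_atTop_nhds_zero_of_lt_one (by norm_num) (by norm_num)).const_mul 4
    rw [mul_zero] at hlim
    refine ge_of_tendsto' hlim fun n => ?_
    rw [one_div_pow, mul_one_div]
    exact dist_circle_le n hγ hinj hK _ _
  have h1 := hinj (dist_le_zero.1 h0)
  have h2 := congrArg (fun u : Circle => Complex.arg u) h1
  rw [Circle.arg_exp (by linarith [Real.pi_pos]) le_rfl] at h2
  simp at h2
  exact Real.pi_pos.ne h2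

/-! ### The branch of `K` at the midpoint of the base -/

/-- The branch of `K` at the point `(2, 0)`. -/
def U : Set (ℝ × ℝ) := {z | z ∈ K ∧ z.1 ≤ 2 ∧ 16 ≤ 8 * z.1 + 9 * z.2}

/-- The branch without its root `(2, 0)`. -/
def V : Set (ℝ × ℝ) := {z | z ∈ U ∧ 0 < z.2}

lemma snd_le_of_mem_K {z : ℝ × ℝ} (hz : z ∈ K) : z.2 ≤ 4 := by
  obtain ⟨h1, h2, h3⟩ := K_subset_T hz
  linarith

lemma fst_le_of_mem_K {z : ℝ × ℝ} (hz : z ∈ K) : z.1 ≤ 4 := by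
  obtain ⟨h1, h2, h3⟩ := K_subset_T hz
  linarith

lemma fst_le_one {z : ℝ × ℝ} (hz : z ∈ K) (h : 2 ≤ z.2) : z.1 ≤ 1 := by
  rcases lt_or_ge z.2 3 with h3 | h3
  · have := fst_le_of_mem_K (Sinv_three_mem_K hz h h3)
    simp only [Sinv_three] at this
    linarith
  · have := fst_le_of_mem_K (Sinv_four_mem_K hz h3)
    simp only [Sinv_four] at this
    linarith

lemma mem_U_of_two_le {z : ℝ × ℝ} (hz : z ∈ K) (h : 2 ≤ z.2) : z ∈ U :=
  ⟨hz, by linarith [fst_le_one hz h], by linarith [(K_subset_T hz).1]⟩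

lemma S_one_mem_U {z : ℝ × ℝ} (hz : z ∈ U) : S 1 z ∈ U := by
  obtain ⟨h1, h2, h3⟩ := hz
  refine ⟨S_mem_K 1 h1, ?_, ?_⟩ <;> simp only [S_one] <;> linarith

lemma Sinv_one_mem_U {z : ℝ × ℝ} (hz : z ∈ U) (h : z.2 < 2) : Sinv 1 z ∈ U := by
  obtain ⟨h1, h2, h3⟩ := hz
  have hK : Sinv 1 z ∈ K := by
    obtain ⟨k, hk⟩ := exists_mem_S_image h1
    rw [mem_S_image] at hk
    obtain ⟨g1, g2, g3⟩ := K_subset_T hk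
    fin_cases k <;> simp only [Fin.zero_eta, Fin.mk_one, Fin.reduceFinMk, Sinv_zero,
      Sinv_two, Sinv_three, Sinv_four] at *
    · exfalso; linarith
    · exact hk
    all_goals exfalso; linarith
  refine ⟨hK, ?_, ?_⟩ <;> simp only [Sinv_one] <;> linarith

lemma eq_root_of_mem_U {z : ℝ × ℝ} (hz : z ∈ U) (h : z.2 = 0) : z = (2, 0) := by
  obtain ⟨-, h2, h3⟩ := hz
  ext <;> dsimp <;> linarith

lemma snd_nonneg_of_mem_U {z : ℝ × ℝ} (hz : z ∈ U) : 0 ≤ z.2 := (K_subset_T hz.1).2.1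

/-- `Sinv 1` fixes the root `(2, 0)` and doubles heights, so every point of `V` comes from a point
of height at least 2 by finitely many applications of `S 1`. -/
lemma V_induction {P : ℝ × ℝ → Prop} (hbase : ∀ z ∈ U, 2 ≤ z.2 → P z)
    (hstep : ∀ z ∈ V, P z → P (S 1 z)) {z : ℝ × ℝ} (hz : z ∈ V) : P z := by
  obtain ⟨n, hn⟩ := exists_pow_lt_of_lt_one (y := (1 / 2 : ℝ)) (x := z.2 / 2)
    (by linarith [hz.2]) (by norm_num)
  induction n generalizing z with
  | zero => exact hbase z hz.1 (by norm_num at hn; linarith)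
  | succ n ih =>
    rcases le_or_gt 2 z.2 with h | h
    · exact hbase z hz.1 h
    · have hz' : Sinv 1 z ∈ V := ⟨Sinv_one_mem_U hz.1 h, by simpa using hz.2⟩
      have := hstep _ hz' (ih hz' (by
        rw [pow_succ] at hn
        simp only [Sinv_one]
        linarith))
      rwa [S_Sinv] at this

/-- The cone defining `U` has its apex at the fixed point of `S 1`, so strictness need only be
checked at height at least 2. The coefficients 8 and 9 put the corner `(0, 2)` strictly inside.
Strict inequalities make `V` relatively open in `K`. -/
lemma mem_V_iff {z : ℝ × ℝ} (hz : z ∈ K) : z ∈ V ↔ z.1 < 2 ∧ 16 < 8 * z.1 + 9 * z.2 := by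
  refine ⟨fun h => ?_, fun h => ⟨⟨hz, h.1.le, h.2.le⟩, by linarith⟩⟩
  refine V_induction (P := fun z => z.1 < 2 ∧ 16 < 8 * z.1 + 9 * z.2) ?_ ?_ h
  · intro z hz h
    have := fst_le_one hz.1 h
    have := (K_subset_T hz.1).1
    constructor <;> linarith
  · rintro z - ⟨h1, h2⟩
    simp only [S_one]
    constructor <;> linarith

lemma two_le_add_of_mem_V {z : ℝ × ℝ} (hz : z ∈ V) : 2 ≤ z.1 + z.2 := by
  refine V_induction (P := fun z => 2 ≤ z.1 + z.2) ?_ ?_ hz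
  · intro z hz h
    have := (K_subset_T hz.1).1
    linarith
  · intro z _ h
    simp only [S_one]
    linarith

lemma isClosed_U : IsClosed U :=
  isClosed_K.inter ((isClosed_le continuous_fst continuous_const).inter
    (isClosed_le (f := fun _ => (16 : ℝ)) continuous_const (by fun_prop)))

lemma isClosed_diff_V : IsClosed (K \ V) := by
  have : K \ V = K ∩ ({z | 2 ≤ z.1} ∪ {z | 8 * z.1 + 9 * z.2 ≤ 16}) := by
    ext z
    simp only [Set.mem_sdiff, mem_inter_iff, mem_union, mem_ofPred_eq]
    refine and_congr_right fun hz => ?_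
    rw [mem_V_iff hz, not_and_or, not_lt, not_lt]
  rw [this]
  exact isClosed_K.inter ((isClosed_le continuous_const continuous_fst).union
    (isClosed_le (by fun_prop) continuous_const))

lemma root_mem_U : ((2, 0) : ℝ × ℝ) ∈ U :=
  ⟨base_mem_K (by norm_num) (by norm_num), by norm_num, by norm_num⟩

lemma C_mem_U : ((0, 4) : ℝ × ℝ) ∈ U := mem_U_of_two_le C_mem_K (by norm_num)

lemma lower_rung_mem_U {x : ℝ} (h0 : 0 ≤ x) (h1 : x ≤ 1) : ((x, 2) : ℝ × ℝ) ∈ U := by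
  refine mem_U_of_two_le ?_ le_rfl
  have := S_mem_K 3 (base_mem_K (x := 4 * x) (by linarith) (by linarith))
  rw [S_three] at this
  convert this using 2 <;> dsimp <;> ring

lemma upper_rung_mem_U : ((1, 3) : ℝ × ℝ) ∈ U := by
  refine mem_U_of_two_le ?_ (by norm_num)
  have := S_mem_K 4 B_mem_K
  rw [S_four] at this
  convert this using 2 <;> norm_num

/-- The branch hangs on the rest of `K` at its root only: adding `K \ V` to the part that contains
the root turns a separation of `U` into one of `K`. -/
lemma isPreconnected_U : IsPreconnected U := by
  rw [isPreconnected_iff_subset_of_fully_disjoint_closed isClosed_U]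
  intro A B hA hB hAB hd
  wlog hp : ((2, 0) : ℝ × ℝ) ∈ A generalizing A B
  · exact (this B A hB hA (union_comm A B ▸ hAB) hd.symm
      ((hAB root_mem_U).resolve_left hp)).symm
  have hroot : ∀ z ∈ U, z ∉ V → z = (2, 0) := fun z hz hzV =>
    eq_root_of_mem_U hz (le_antisymm (not_lt.1 fun h => hzV ⟨hz, h⟩) (snd_nonneg_of_mem_U hz))
  have hdis : Disjoint (A ∩ U ∪ K \ V) (B ∩ U) := by
    rw [disjoint_left]
    rintro z (h | h) h'
    · exact disjoint_left.1 hd h.1 h'.1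
    · exact disjoint_left.1 hd hp (hroot z h'.2 h.2 ▸ h'.1)
  have hcov : K ⊆ A ∩ U ∪ K \ V ∪ B ∩ U := by
    intro z hz
    by_cases hzV : z ∈ V
    · rcases hAB hzV.1 with h | h
      · exact Or.inl (Or.inl ⟨h, hzV.1⟩)
      · exact Or.inr ⟨h, hzV.1⟩
    · exact Or.inl (Or.inr ⟨hz, hzV⟩)
  rcases (isPreconnected_iff_subset_of_fully_disjoint_closed isClosed_K).1 isPreconnected_K _ _
    ((hA.inter isClosed_U).union isClosed_diff_V) (hB.inter isClosed_U) hcov hdis with h | h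
  · left
    intro z hz
    rcases h hz.1 with h' | h'
    · exact h'.1
    · exact hroot z hz h'.2 ▸ hp
  · exact absurd (h root_mem_U.1).1 (disjoint_left.1 hd hp)

/-- Two points of the branch at height `y` have distance at most `y / 2`, with equality only for
the endpoints of the lowest rung and its images. -/
lemma width_U {x₁ x₂ y : ℝ} (h1 : (x₁, y) ∈ U) (h2 : (x₂, y) ∈ U) (hy : 0 < y) :
    x₂ - x₁ ≤ y / 2 ∧ (x₂ - x₁ = y / 2 →
      ∃ n : ℕ, y = 2 / 2 ^ n ∧ x₁ = 2 - 2 / 2 ^ n ∧ x₂ = 2 - 1 / 2 ^ n) := by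
  have key := V_induction (z := (x₁, y)) (P := fun z => ∀ x₂, (x₂, z.2) ∈ U →
    x₂ - z.1 ≤ z.2 / 2 ∧ (x₂ - z.1 = z.2 / 2 →
      ∃ n : ℕ, z.2 = 2 / 2 ^ n ∧ z.1 = 2 - 2 / 2 ^ n ∧ x₂ = 2 - 1 / 2 ^ n)) ?_ ?_ ⟨h1, hy⟩
  · exact key x₂ h2
  · intro z hz h x₂ h2
    have g1 := (K_subset_T hz.1).1
    have g2 := fst_le_one h2.1 h
    dsimp only at g2
    refine ⟨by linarith, fun heq => ⟨0, ?_, ?_, ?_⟩⟩ <;> norm_num <;> linarith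
  · intro z hz ih x₂ h2
    simp only [S_one] at h2 ⊢
    -- Height 4 occurs only at the tip `(0, 4)`. Its image `(1, 2)` is the right end of the lower
    -- rung, where `Sinv 1` need not apply to the second point.
    rcases lt_or_ge z.2 4 with h4 | h4
    · have h2' := Sinv_one_mem_U h2 (by dsimp; linarith)
      simp only [Sinv_one] at h2'
      rw [mul_div_cancel₀ _ two_ne_zero] at h2'
      obtain ⟨i1, i2⟩ := ih _ h2'
      refine ⟨by linarith, fun heq => ?_⟩
      obtain ⟨n, e1, e2, e3⟩ := i2 (by linarith)
      have e4 : (2 : ℝ) / 2 ^ (n + 1) = (2 / 2 ^ n) / 2 := by rw [pow_succ]; field_simp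
      have e5 : (1 : ℝ) / 2 ^ (n + 1) = (1 / 2 ^ n) / 2 := by rw [pow_succ]; field_simp
      refine ⟨n + 1, ?_, ?_, ?_⟩ <;> linarith
    · have g0 := K_subset_T hz.1.1
      have g1 := g0.1
      have g2 := g0.2.2
      have g3 := fst_le_one h2.1 (by dsimp; linarith)
      dsimp only at g3
      have : z.2 = 4 := by linarith
      refine ⟨by linarith, fun heq => ?_⟩
      exfalso; linarith

/-! ### Branches along the base -/

/-- `Br β r` means that the dendrite has at the point `(β, 0)` of its base a branch that is
similar to the one at `(2, 0)` with ratio `r`. -/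
inductive Br : ℝ → ℝ → Prop
  | center : Br 2 1
  | left {β r : ℝ} : Br β r → Br (β / 4) (r / 4)
  | right {β r : ℝ} : Br β r → Br (β / 4 + 3) (r / 4)
  | middle {β r : ℝ} : Br β r → β ≠ 2 → Br (β / 2 + 1) (r / 2)

/-- The homothety of ratio `r` that maps `(2, 0)` to `(β, 0)`. -/
def H (β r : ℝ) (z : ℝ × ℝ) : ℝ × ℝ := (β + r * (z.1 - 2), r * z.2)

lemma Br.pos {β r : ℝ} (h : Br β r) : 0 < r := by
  induction h <;> linarith

lemma Br.le_one {β r : ℝ} (h : Br β r) : r ≤ 1 := by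
  induction h with
  | center => exact le_rfl
  | left h ih => linarith [h.pos]
  | right h ih => linarith [h.pos]
  | middle h _ ih => linarith [h.pos]

/-- The second alternative is the orbit of the central branch under `S 0`, which accumulates at the
end of the base. That its ratios are powers of `1 / 4` is what makes gaps on both sides of a
junction comparable. -/
lemma Br.left_gap {β r : ℝ} (h : Br β r) :
    4 * r ≤ β ∨ β = 2 * r ∧ ∃ n : ℕ, r = 1 / 4 ^ n := by
  induction h with
  | center => exact Or.inr ⟨by norm_num, 0, by norm_num⟩
  | left h ih =>
    rcases ih with h1 | ⟨h1, n, hn⟩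
    · left; linarith
    · exact Or.inr ⟨by linarith, n + 1, by rw [hn, pow_succ]; field_simp⟩
  | right h ih =>
    have := h.pos
    have := h.le_one
    left; rcases ih with h1 | ⟨h1, -⟩ <;> linarith
  | middle h _ ih =>
    have := h.pos
    have := h.le_one
    left; rcases ih with h1 | ⟨h1, -⟩ <;> linarith

lemma Br.right_gap {β r : ℝ} (h : Br β r) :
    4 * r ≤ 4 - β ∨ 4 - β = 2 * r ∧ ∃ n : ℕ, r = 1 / 4 ^ n := by
  induction h with
  | center => exact Or.inr ⟨by norm_num, 0, by norm_num⟩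
  | right h ih =>
    rcases ih with h1 | ⟨h1, n, hn⟩
    · left; linarith
    · exact Or.inr ⟨by linarith, n + 1, by rw [hn, pow_succ]; field_simp⟩
  | left h ih =>
    have := h.pos
    have := h.le_one
    left; rcases ih with h1 | ⟨h1, -⟩ <;> linarith
  | middle h _ ih =>
    have := h.pos
    have := h.le_one
    left; rcases ih with h1 | ⟨h1, -⟩ <;> linarith

lemma Br.two_mul_le {β r : ℝ} (h : Br β r) : 2 * r ≤ β ∧ 2 * r ≤ 4 - β := by
  have := h.pos
  constructor
  · rcases h.left_gap with h | ⟨h, -⟩ <;> linarith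
  · rcases h.right_gap with h | ⟨h, -⟩ <;> linarith

lemma Br.center_gap {β r : ℝ} (h : Br β r) : β = 2 ∧ r = 1 ∨ 6 * r ≤ |β - 2| := by
  induction h with
  | center => exact Or.inl ⟨rfl, rfl⟩
  | left h ih =>
    right
    rw [le_abs]
    right
    linarith [h.two_mul_le.2, h.le_one]
  | right h ih =>
    right
    rw [le_abs]
    left
    linarith [h.two_mul_le.1, h.le_one]
  | @middle β r h hne ih =>
    right
    have := ih.resolve_left fun h => hne h.1
    have e : β / 2 + 1 - 2 = (β - 2) / 2 := by ring
    rw [e, abs_div, abs_two]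
    linarith

/-- Two branches on different sides of a junction, one of which belongs to a piece with ratio
`1 / 4` and the other to a piece with ratio `1 / 2`. -/
lemma six_mul_min_le {g g' r r' : ℝ} (hr' : 0 < r')
    (h : 4 * r ≤ g ∨ g = 2 * r ∧ ∃ n : ℕ, r = 1 / 4 ^ n)
    (h' : 4 * r' ≤ g' ∨ g' = 2 * r' ∧ ∃ n : ℕ, r' = 1 / 4 ^ n) :
    6 * min (r / 4) (r' / 2) ≤ g / 4 + g' / 2 := by
  have m1 := min_le_left (r / 4) (r' / 2)
  have m2 := min_le_right (r / 4) (r' / 2)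
  rcases h with h | ⟨h, n, hn⟩
  · rcases h' with h' | ⟨h', -⟩ <;> linarith
  rcases h' with h' | ⟨h', m, hm⟩
  · linarith
  -- Both gaps are exceptional, so the sum is `r / 2 + r'`. Either `r' ≤ r / 4` or `r ≤ r'`, and
  -- each suffices.
  rcases lt_or_ge n m with hnm | hnm
  · have : r' ≤ r / 4 := by
      rw [hn, hm, div_div, ← pow_succ]
      exact one_div_le_one_div_of_le (by positivity) (pow_le_pow_right₀ (by norm_num) hnm)
    linarith
  · have : r ≤ r' := by
      rw [hn, hm]
      exact one_div_le_one_div_of_le (by positivity) (pow_le_pow_right₀ (by norm_num) hnm)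
    linarith

/-- Within one piece the bound scales; across a junction it is `six_mul_min_le`; the two outer
pieces are far apart. The constant 6 is attained by the roots 2 and `1 / 2`, the pair used in
`upper_le_abs`. -/
lemma Br.separation {β r β' r' : ℝ} (h : Br β r) (h' : Br β' r') :
    β = β' ∧ r = r' ∨ 6 * min r r' ≤ |β - β'| := by
  have scale : ∀ {c x a b : ℝ}, 0 < c → 6 * min a b ≤ |x| → 6 * min (a / c) (b / c) ≤ |x / c| := by
    intro c x a b hc hx
    rw [min_div_div_right hc.le, abs_div, abs_of_pos hc, ← mul_div_assoc]
    exact div_le_div_of_nonneg_right hx hc.le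
  induction h generalizing β' r' with
  | center =>
    rcases h'.center_gap with ⟨h1, h2⟩ | h1
    · exact Or.inl ⟨h1.symm, h2.symm⟩
    · rw [abs_sub_comm]
      exact Or.inr (le_trans (by linarith [min_le_right 1 r']) h1)
  | @left β r h ih =>
    cases h' with
    | center =>
      rcases h.left.center_gap with ⟨h1, h2⟩ | h1
      · exact Or.inl ⟨h1, h2⟩
      · exact Or.inr (le_trans (by linarith [min_le_left (r / 4) 1]) h1)
    | @left β' r' h' =>
      rcases ih h' with ⟨h1, h2⟩ | h1
      · exact Or.inl ⟨by rw [h1], by rw [h2]⟩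
      · rw [← sub_div]
        exact Or.inr (scale (by norm_num) h1)
    | @right β' r' h' =>
      right
      rw [le_abs]
      right
      linarith [h.two_mul_le.2, h.le_one, h'.two_mul_le.1, h'.le_one, h.pos, h'.pos,
        min_le_left (r / 4) (r' / 4)]
    | @middle β' r' h' hne =>
      right
      rw [le_abs]
      right
      linarith [six_mul_min_le h'.pos h.right_gap h'.left_gap]
  | @right β r h ih =>
    cases h' with
    | center =>
      rcases h.right.center_gap with ⟨h1, h2⟩ | h1
      · exact Or.inl ⟨h1, h2⟩
      · exact Or.inr (le_trans (by linarith [min_le_left (r / 4) 1]) h1)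
    | @right β' r' h' =>
      rcases ih h' with ⟨h1, h2⟩ | h1
      · exact Or.inl ⟨by rw [h1], by rw [h2]⟩
      · rw [add_sub_add_right_eq_sub, ← sub_div]
        exact Or.inr (scale (by norm_num) h1)
    | @left β' r' h' =>
      right
      rw [le_abs]
      left
      linarith [h'.two_mul_le.2, h.le_one, h.two_mul_le.1, h'.le_one, h.pos, h'.pos,
        min_le_left (r / 4) (r' / 4)]
    | @middle β' r' h' hne =>
      right
      rw [le_abs]
      left
      linarith [six_mul_min_le h'.pos h.left_gap h'.right_gap]
  | @middle β r h hne ih =>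
    cases h' with
    | center =>
      rcases (h.middle hne).center_gap with ⟨h1, h2⟩ | h1
      · exact Or.inl ⟨h1, h2⟩
      · exact Or.inr (le_trans (by linarith [min_le_left (r / 2) 1]) h1)
    | @left β' r' h' =>
      right
      rw [le_abs]
      left
      have := six_mul_min_le h.pos h'.right_gap h.left_gap
      rw [min_comm] at this
      linarith
    | @right β' r' h' =>
      right
      rw [le_abs]
      right
      have := six_mul_min_le h.pos h'.left_gap h.right_gap
      rw [min_comm] at this
      linarith
    | @middle β' r' h' hne' =>
      rcases ih h' with ⟨h1, h2⟩ | h1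
      · exact Or.inl ⟨by rw [h1], by rw [h2]⟩
      · rw [add_sub_add_right_eq_sub, ← sub_div]
        exact Or.inr (scale (by norm_num) h1)

lemma Br.ratio_unique {β r r' : ℝ} (h : Br β r) (h' : Br β r') : r = r' := by
  rcases h.separation h' with h1 | h1
  · exact h1.2
  · rw [sub_self, abs_zero] at h1
    have := lt_min h.pos h'.pos
    linarith

@[simp] lemma H_center (z : ℝ × ℝ) : H 2 1 z = z := by simp [H]

lemma S_zero_H (β r : ℝ) (z : ℝ × ℝ) : S 0 (H β r z) = H (β / 4) (r / 4) z := by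
  ext <;> simp [H] <;> ring

lemma S_one_H (β r : ℝ) (z : ℝ × ℝ) : S 1 (H β r z) = H (β / 2 + 1) (r / 2) z := by
  ext <;> simp [H] <;> ring

lemma S_two_H (β r : ℝ) (z : ℝ × ℝ) : S 2 (H β r z) = H (β / 4 + 3) (r / 4) z := by
  ext <;> simp [H] <;> ring

lemma Br.exists_wordMap_eq {β r : ℝ} (h : Br β r) : ∃ w, wordMap S w = H β r := by
  induction h with
  | center => exact ⟨[], by ext1 z; rw [H_center]; rfl⟩
  | left h ih =>
    obtain ⟨w, hw⟩ := ih
    exact ⟨0 :: w, by ext1 z; rw [wordMap_cons, hw, S_zero_H]⟩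
  | right h ih =>
    obtain ⟨w, hw⟩ := ih
    exact ⟨2 :: w, by ext1 z; rw [wordMap_cons, hw, S_two_H]⟩
  | middle h _ ih =>
    obtain ⟨w, hw⟩ := ih
    exact ⟨1 :: w, by ext1 z; rw [wordMap_cons, hw, S_one_H]⟩

lemma Br.H_mem_K {β r : ℝ} (h : Br β r) {z : ℝ × ℝ} (hz : z ∈ K) : H β r z ∈ K := by
  obtain ⟨w, hw⟩ := h.exists_wordMap_eq
  exact hw ▸ wordMap_mem_K w hz

/-- The points of `K` above the base belong to branches. -/
lemma exists_branch {z : ℝ × ℝ} (hz : z ∈ K) (h0 : 0 < z.2) :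
    ∃ β r, Br β r ∧ z ∈ H β r '' V := by
  obtain ⟨n, hn⟩ := exists_pow_lt_of_lt_one (y := (1 / 2 : ℝ)) (x := z.2 / 2)
    (by linarith) (by norm_num)
  have high : ∀ z ∈ K, 2 ≤ z.2 → ∃ β r, Br β r ∧ z ∈ H β r '' V := fun z hz h =>
    ⟨2, 1, .center, z, ⟨mem_U_of_two_le hz h, by linarith⟩, H_center z⟩
  induction n generalizing z with
  | zero => exact high z hz (by norm_num at hn; linarith)
  | succ n ih =>
    rcases le_or_gt 2 z.2 with h | h
    · exact high z hz h
    rw [pow_succ] at hn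
    obtain ⟨k, hk⟩ := exists_mem_S_image hz
    rw [mem_S_image] at hk
    have hT := K_subset_T hk
    have hpow : 0 < (1 / 2 : ℝ) ^ n := by positivity
    fin_cases k <;> simp only [Fin.zero_eta, Fin.mk_one, Fin.reduceFinMk] at hk hT
    · obtain ⟨β, r, hb, y, hy, hyz⟩ := ih hk (by simpa using h0) (by simp only [Sinv_zero]; linarith)
      exact ⟨_, _, hb.left, y, hy, by rw [← S_zero_H, hyz, S_Sinv]⟩
    · obtain ⟨β, r, hb, y, hy, hyz⟩ := ih hk (by simpa using h0) (by simp only [Sinv_one]; linarith)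
      -- `S 1` sends the central branch into itself, so this case creates no new root. This is why
      -- `Br.middle` excludes it.
      by_cases hβ : β = 2
      · subst hβ
        obtain rfl := hb.ratio_unique .center
        refine ⟨2, 1, .center, S 1 y, ⟨S_one_mem_U hy.1, ?_⟩, ?_⟩
        · simpa using hy.2
        · rw [H_center] at hyz ⊢
          rw [hyz, S_Sinv]
      · exact ⟨_, _, hb.middle hβ, y, hy, by rw [← S_one_H, hyz, S_Sinv]⟩
    · obtain ⟨β, r, hb, y, hy, hyz⟩ := ih hk (by simpa using h0) (by simp only [Sinv_two]; linarith)
      exact ⟨_, _, hb.right, y, hy, by rw [← S_two_H, hyz, S_Sinv]⟩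
    · have := hT.2.1
      simp only [Sinv_three] at this
      linarith
    · have := hT.2.1
      simp only [Sinv_four] at this
      linarith

lemma Br.snd_of_mem {β r : ℝ} (h : Br β r) {z : ℝ × ℝ} (hz : z ∈ H β r '' V) :
    0 < z.2 ∧ z.2 ≤ 4 * r := by
  obtain ⟨y, hy, rfl⟩ := hz
  have := h.pos
  have := snd_le_of_mem_K hy.1.1
  refine ⟨mul_pos h.pos hy.2, ?_⟩
  simp only [H]
  nlinarith

/-- The branches without their roots are relatively open in `K`. -/
lemma Br.isClosed_diff {β r : ℝ} (h : Br β r) : IsClosed (K \ H β r '' V) := by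
  have contact : ∀ k : Fin 5, ∀ W ⊆ K, (∀ z ∈ W, 0 < z.2) → (∀ z ∈ W, k = 1 → z.2 < 4) →
      (k = 0 ∨ k = 1 ∨ k = 2) → ∀ j ≠ k, ∀ z ∈ W, Sinv j (S k z) ∉ T := by
    rintro k W hWK hW0 hW4 hk j hjk z hz hT
    have hzT := K_subset_T (hWK hz)
    have h0 := hW0 z hz
    have h4 := hW4 z hz
    obtain ⟨g1, g2, g3⟩ := hzT
    obtain ⟨h1, h2, h3⟩ := hT
    rcases hk with rfl | rfl | rfl <;> fin_cases j <;> first | exact hjk rfl | skip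
    all_goals
      simp only [Fin.zero_eta, Fin.mk_one, Fin.reduceFinMk, Sinv_zero, Sinv_one, Sinv_two,
        Sinv_three, Sinv_four, S_zero, S_one, S_two, forall_const] at *
      linarith
  have sub : ∀ {β r : ℝ}, Br β r → H β r '' V ⊆ K := by
    rintro β r h _ ⟨z, hz, rfl⟩
    exact h.H_mem_K hz.1.1
  induction h with
  | center =>
    have : H 2 1 '' V = V := by
      simp
    rw [this]
    exact isClosed_diff_V
  | @left β r h ih =>
    have : H (β / 4) (r / 4) '' V = S 0 '' (H β r '' V) := by
      rw [image_image]
      exact image_congr fun z _ => (S_zero_H β r z).symm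
    rw [this]
    exact isClosed_diff_S_image ih (contact 0 _ (sub h) (fun z hz => (h.snd_of_mem hz).1)
      (fun _ _ h => by simp at h) (by simp))
  | @right β r h ih =>
    have : H (β / 4 + 3) (r / 4) '' V = S 2 '' (H β r '' V) := by
      rw [image_image]
      exact image_congr fun z _ => (S_two_H β r z).symm
    rw [this]
    exact isClosed_diff_S_image ih (contact 2 _ (sub h) (fun z hz => (h.snd_of_mem hz).1)
      (fun _ _ h => by simp at h) (by simp))
  | @middle β r h hne ih =>
    have : H (β / 2 + 1) (r / 2) '' V = S 1 '' (H β r '' V) := by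
      rw [image_image]
      exact image_congr fun z _ => (S_one_H β r z).symm
    rw [this]
    refine isClosed_diff_S_image ih (contact 1 _ (sub h) (fun z hz => (h.snd_of_mem hz).1)
      (fun z hz _ => ?_) (by simp))
    -- Only the tip of height 4 would be carried by `S 1` to the contact point `(1, 2)`. A branch
    -- other than the central one has height at most `4 * r`, which is below 4.
    have h6 := h.center_gap.resolve_left fun h => hne h.1
    have h4 := (h.snd_of_mem hz).2
    have h2 : |β - 2| ≤ 2 := by
      rw [abs_le]
      constructor <;> linarith [h.two_mul_le, h.pos]
    linarith

/-- A connected subset of `K` that meets the base in one point only lies in the branch at this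
point. -/
lemma exists_branch_of_isPreconnected {X : Set (ℝ × ℝ)} (hX : IsPreconnected X) (hXK : X ⊆ K)
    {s z₀ : ℝ × ℝ} (hs0 : s.2 = 0) (hs : ∀ z ∈ X, z.2 = 0 → z = s) (hz₀ : z₀ ∈ X)
    (h0 : 0 < z₀.2) (hsX : s ∈ X) : ∃ β r, Br β r ∧ s = (β, 0) ∧ X ⊆ H β r '' U := by
  have root : ∀ z ∈ X, 0 < z.2 → ∃ β r, Br β r ∧ s = (β, 0) ∧ z ∈ H β r '' V := by
    intro z hz hz0
    obtain ⟨β, r, hb, hzb⟩ := exists_branch (hXK hz) hz0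
    refine ⟨β, r, hb, ?_, hzb⟩
    have hUcl : IsClosed (H β r '' U) := by
      have : IsCompact U := isCompact_K.of_isClosed_subset isClosed_U fun z hz => hz.1
      refine (this.image ?_).isClosed
      unfold H
      fun_prop
    -- The closed branch and the complement of the rootless branch have only the root in common, so
    -- `X` passes through the root, which must then be `s`.
    obtain ⟨y, hyX, ⟨u, hu, rfl⟩, hy⟩ := isPreconnected_closed_iff.1 hX _ _ hUcl hb.isClosed_diff
      (fun y hy => by
        by_cases hyV : y ∈ H β r '' V
        · exact Or.inl (image_mono (fun z hz => hz.1) hyV)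
        · exact Or.inr ⟨hXK hy, hyV⟩)
      ⟨z, hz, image_mono (fun z hz => hz.1) hzb⟩
      ⟨s, hsX, hXK hsX, fun h => (hb.snd_of_mem h).1.ne' hs0⟩
    have hu0 : u.2 = 0 := le_antisymm
      (not_lt.1 fun h => hy.2 (mem_image_of_mem _ ⟨hu, h⟩)) (snd_nonneg_of_mem_U hu)
    rw [eq_root_of_mem_U hu hu0] at hyX
    rw [← hs _ hyX (by simp [H])]
    simp [H]
  obtain ⟨β, r, hb, hsb, -⟩ := root z₀ hz₀ h0
  refine ⟨β, r, hb, hsb, fun z hz => ?_⟩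
  rcases (K_subset_T (hXK hz)).2.1.eq_or_lt with hz0 | hz0
  · rw [hs z hz hz0.symm, hsb]
    exact ⟨(2, 0), root_mem_U, by simp [H]⟩
  · obtain ⟨β', r', hb', hsb', hz'⟩ := root z hz hz0
    obtain rfl : β = β' := congrArg Prod.fst (hsb.symm.trans hsb')
    obtain rfl := hb.ratio_unique hb'
    exact image_mono (fun z hz => hz.1) hz'

/-! ### Affine maps of `K` into itself -/

/-- The affine map with upper triangular linear part that maps the base line to itself. -/
def upper (a b d e : ℝ) (z : ℝ × ℝ) : ℝ × ℝ := (a * z.1 + b * z.2 + e, d * z.2)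

lemma continuous_upper (a b d e : ℝ) : Continuous (upper a b d e) := by
  unfold upper
  fun_prop

lemma continuous_H (β r : ℝ) : Continuous (H β r) := by
  unfold H
  fun_prop

/-- As `d > 0`, the image of a branch is connected and meets the base only in the image of the root,
hence lies in one branch. -/
lemma upper_image_branch {a b d e β₀ r₀ : ℝ} (hd : 0 < d) (hK : MapsTo (upper a b d e) K K)
    (h₀ : Br β₀ r₀) : ∃ β r, Br β r ∧ a * β₀ + e = β ∧
      ∀ z ∈ U, upper a b d e (H β₀ r₀ z) ∈ H β r '' U := by
  obtain ⟨β, r, hb, hs, hsub⟩ := exists_branch_of_isPreconnected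
    (X := (fun z => upper a b d e (H β₀ r₀ z)) '' U) (s := (a * β₀ + e, 0))
    (z₀ := upper a b d e (H β₀ r₀ (0, 4)))
    (isPreconnected_U.image _
      ((continuous_upper a b d e).comp (continuous_H β₀ r₀)).continuousOn)
    (by rintro _ ⟨z, hz, rfl⟩; exact hK (h₀.H_mem_K hz.1))
    rfl
    (by
      rintro _ ⟨z, hz, rfl⟩ h0
      have hz0 : z.2 = 0 := by simpa [upper, H, hd.ne', h₀.pos.ne'] using h0
      rw [eq_root_of_mem_U hz hz0]
      simp [upper, H])
    (mem_image_of_mem _ C_mem_U)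
    (mul_pos hd (mul_pos h₀.pos (by norm_num)))
    ⟨(2, 0), root_mem_U, by simp [upper, H]⟩
  exact ⟨β, r, hb, congrArg Prod.fst hs, fun z hz => hsub (mem_image_of_mem _ hz)⟩

/-- An affine self-map of the branch that does not shrink the base more than the heights is a
homothety. -/
lemma upper_branch_rigid {a b d : ℝ} (hd : 0 < d) (had : d ≤ |a|)
    (h : ∀ z ∈ U, (2 + (a * (z.1 - 2) + b * z.2), d * z.2) ∈ U) :
    b = 0 ∧ a = d ∧ ∃ n : ℕ, d = 1 / 2 ^ n := by
  have h0 := h _ (lower_rung_mem_U le_rfl zero_le_one)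
  have h1 := h _ (lower_rung_mem_U zero_le_one le_rfl)
  have h3 := h _ upper_rung_mem_U
  dsimp only at h0 h1 h3
  -- The image of the lower rung has width `|a| ≥ d` at height `2 * d`: the equality case of
  -- `width_U`. Its left end then determines `b`. If `a < 0`, this gives `b = -3 / 2 * d`, and the
  -- image of `(1, 3)` violates `two_le_add_of_mem_V`.
  rcases le_or_gt 0 a with ha | ha
  · rw [abs_of_nonneg ha] at had
    obtain ⟨w1, w2⟩ := width_U h0 h1 (by linarith)
    obtain ⟨n, e1, e2, e3⟩ := w2 (by linarith)
    rw [div_eq_mul_one_div] at e1 e2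
    refine ⟨by linarith, by linarith, n, by linarith⟩
  · rw [abs_of_neg ha] at had
    obtain ⟨w1, w2⟩ := width_U h1 h0 (by linarith)
    obtain ⟨n, e1, e2, e3⟩ := w2 (by linarith)
    have := two_le_add_of_mem_V ⟨h3, by dsimp; linarith⟩
    dsimp only at this
    exfalso
    linarith

lemma upper_branch_rigid_of_mem {a b d e β r : ℝ} (hd : 0 < d) (had : d ≤ |a|) (hb : Br β r)
    (hβ : a * 2 + e = β) (h : ∀ z ∈ U, upper a b d e z ∈ H β r '' U) :
    b = 0 ∧ a = d ∧ ∃ n : ℕ, d = r / 2 ^ n := by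
  have hr := hb.pos
  obtain ⟨h1, h2, n, hn⟩ := upper_branch_rigid (a := a / r) (b := b / r) (d := d / r)
    (div_pos hd hr) (by rw [abs_div, abs_of_pos hr]; exact div_le_div_of_nonneg_right had hr.le)
    (fun z hz => by
      obtain ⟨u, hu, huz⟩ := h z hz
      have e1 : β + r * (u.1 - 2) = a * z.1 + b * z.2 + e := congrArg Prod.fst huz
      have e2 : r * u.2 = d * z.2 := congrArg Prod.snd huz
      convert hu using 1
      ext
      · dsimp only
        field_simp
        linarith
      · dsimp only
        field_simp
        linarith)
  refine ⟨by simpa [hr.ne'] using h1, ?_, n, ?_⟩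
  · field_simp at h2
    exact h2
  · rw [div_eq_iff hr.ne'] at hn
    rw [hn]
    ring

/-- The branches at 2 and `1 / 2` have tips at heights 4 and 1, so the branches receiving them have
ratios at least `d` and `d / 4`. Their roots are `3 / 2 * |a|` apart, and separation requires at
least `6 * (d / 4)`. -/
lemma upper_le_abs {a b d e : ℝ} (ha : a ≠ 0) (hd : 0 < d)
    (hK : MapsTo (upper a b d e) K K) : d ≤ |a| := by
  obtain ⟨β₁, r₁, hb₁, hβ₁, h₁⟩ := upper_image_branch hd hK .center
  obtain ⟨β₂, r₂, hb₂, hβ₂, h₂⟩ := upper_image_branch hd hK (Br.left .center)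
  obtain ⟨u₁, hu₁, e₁⟩ := h₁ _ C_mem_U
  obtain ⟨u₂, hu₂, e₂⟩ := h₂ _ C_mem_U
  have k₁ : r₁ * u₁.2 = d * (1 * 4) := congrArg Prod.snd e₁
  have k₂ : r₂ * u₂.2 = d * (1 / 4 * 4) := congrArg Prod.snd e₂
  have m₁ := mul_le_mul_of_nonneg_left (snd_le_of_mem_K hu₁.1) hb₁.pos.le
  have m₂ := mul_le_mul_of_nonneg_left (snd_le_of_mem_K hu₂.1) hb₂.pos.le
  have hdiff : β₁ - β₂ = a * (3 / 2) := by rw [← hβ₁, ← hβ₂]; ring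
  have hmin : d / 4 ≤ min r₁ r₂ := le_min (by linarith) (by linarith)
  rcases hb₁.separation hb₂ with ⟨h, -⟩ | h
  · rw [h, sub_self] at hdiff
    exact absurd hdiff.symm (by simpa using ha)
  · rw [hdiff, abs_mul, abs_of_pos (by norm_num : (0 : ℝ) < 3 / 2)] at h
    linarith

lemma H_two_eq_wordMap (n : ℕ) : wordMap S (List.replicate n 1) = H 2 (1 / 2 ^ n) := by
  induction n with
  | zero => ext1 z; rw [pow_zero, div_one, H_center]; rfl
  | succ n ih =>
    ext1 z
    rw [List.replicate_succ, wordMap_cons, ih, S_one_H, pow_succ, div_div]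
    norm_num

lemma H_two_mem_K (n : ℕ) {z : ℝ × ℝ} (hz : z ∈ K) : H 2 (1 / 2 ^ n) z ∈ K :=
  H_two_eq_wordMap n ▸ wordMap_mem_K _ hz

lemma exists_one_div_two_pow_lt {ε : ℝ} (hε : 0 < ε) : ∃ n : ℕ, 1 / 2 ^ n < ε := by
  obtain ⟨n, hn⟩ := exists_pow_lt_of_lt_one (y := (1 / 2 : ℝ)) hε (by norm_num)
  exact ⟨n, by rwa [one_div_pow] at hn⟩

lemma upper_pos {a b d e : ℝ} (ha : a ≠ 0) (hK : MapsTo (upper a b d e) K K)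
    (hinj : InjOn (upper a b d e) K) : 0 < d := by
  have hC := (K_subset_T (hK C_mem_K)).2.1
  simp only [upper] at hC
  refine lt_of_le_of_ne (by linarith) fun hd => ?_
  -- If `d = 0`, the map projects onto the base along a fixed direction. For small `ε` the tip of
  -- the copy `H 2 ε` of `K` and a point of the base have the same image, against injectivity.
  obtain ⟨n, hn⟩ := exists_one_div_two_pow_lt (ε := 2 / (|4 * b / a - 2| + 1)) (by positivity)
  set ε : ℝ := 1 / 2 ^ n with hε
  have hε0 : 0 < ε := by positivity
  have hsmall : |(4 * b / a - 2) * ε| ≤ 2 := by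
    rw [abs_mul, abs_of_pos hε0]
    rw [lt_div_iff₀ (by positivity)] at hn
    nlinarith
  rw [abs_le] at hsmall
  have h1 := base_mem_K (x := 2 + (4 * b / a - 2) * ε) (by linarith) (by linarith)
  have h2 := H_two_mem_K n C_mem_K
  rw [← hε] at h2
  have := hinj h1 h2 (by
    ext
    · simp only [upper, H]
      field_simp
      ring
    · simp [upper, ← hd])
  have h3 : (0 : ℝ) = ε * 4 := congrArg Prod.snd this
  linarith

lemma upper_rigid {a b d e : ℝ} (ha : a ≠ 0) (hK : MapsTo (upper a b d e) K K)
    (hinj : InjOn (upper a b d e) K) : b = 0 ∧ a = d ∧ 0 < d := by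
  have hd := upper_pos ha hK hinj
  obtain ⟨β, r, hb, hβ, h⟩ := upper_image_branch hd hK .center
  obtain ⟨h1, h2, -⟩ := upper_branch_rigid_of_mem hd (upper_le_abs ha hd hK) hb hβ
    (fun z hz => by simpa using h z hz)
  exact ⟨h1, h2, hd⟩

/-- The central branch lands in a branch `H β r '' U` with its root on the root, and rigidity gives
`c = r / 2 ^ n`. So the map is `H β r` after the `n`-th power of `S 1`. -/
lemma homothety_eq_wordMap {c e : ℝ} (hc : 0 < c) (hK : MapsTo (upper c 0 c e) K K) :
    ∃ w, upper c 0 c e = wordMap S w := by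
  obtain ⟨β, r, hb, hβ, h⟩ := upper_image_branch hc hK .center
  obtain ⟨-, -, n, hn⟩ := upper_branch_rigid_of_mem hc (le_abs_self c) hb hβ
    (fun z hz => by simpa using h z hz)
  obtain ⟨w, hw⟩ := hb.exists_wordMap_eq
  refine ⟨w ++ List.replicate n 1, ?_⟩
  ext1 z
  rw [wordMap_append, hw, H_two_eq_wordMap, ← hβ, hn]
  ext
  · simp only [upper, H]
    field_simp
    ring
  · simp only [upper, H]
    field_simp

/-- The injective affine maps of `K` into itself are compositions of maps of the system. -/
theorem affine_eq_wordMap (f : (ℝ × ℝ) →ᵃ[ℝ] (ℝ × ℝ)) (hinj : InjOn f K)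
    (hK : MapsTo f K K) : ∃ w, ⇑f = wordMap S w := by
  obtain ⟨a, b, c, d, e, g, hf⟩ : ∃ a b c d e g : ℝ, ∀ z : ℝ × ℝ,
      f z = (a * z.1 + b * z.2 + e, c * z.1 + d * z.2 + g) := by
    refine ⟨(f.linear (1, 0)).1, (f.linear (0, 1)).1, (f.linear (1, 0)).2, (f.linear (0, 1)).2,
      (f 0).1, (f 0).2, fun z => ?_⟩
    have h1 : f z = f.linear z + f 0 := by simpa using f.map_vadd 0 z
    have h2 : z = z.1 • ((1, 0) : ℝ × ℝ) + z.2 • ((0, 1) : ℝ × ℝ) := by ext <;> simp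
    rw [h1]
    conv_lhs => rw [h2, map_add, map_smul, map_smul]
    ext <;> simp <;> ring
  have hcont : Continuous f := by
    have : (f : ℝ × ℝ → ℝ × ℝ) = fun z => (a * z.1 + b * z.2 + e, c * z.1 + d * z.2 + g) :=
      funext hf
    rw [this]
    fun_prop
  have hseg : segment ℝ (f (0, 0)) (f (4, 0)) ⊆ K := by
    rw [← image_segment]
    rintro _ ⟨z, hz, rfl⟩
    exact hK (base_segment_subset hz)
  have hne : f (0, 0) ≠ f (4, 0) := fun h => by
    have := congrArg Prod.fst (hinj A_mem_K B_mem_K h)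
    norm_num at this
  have hc : c = 0 := by
    have := snd_eq_of_segment_subset hseg
    simp only [hf] at this
    linarith
  subst hc
  have ha : a ≠ 0 := by
    rintro rfl
    exact hne (by simp [hf])
  obtain ⟨v, -, -, hv, -⟩ := exists_maxSegment hne hseg
  obtain ⟨r, hr, t, ht⟩ := exists_wordMap_eq v
  -- the map `f` in the coordinates of the piece that contains the image of the base
  set h : ℝ × ℝ → ℝ × ℝ := fun z => r⁻¹ • (f z - t) with hdef
  have hfh : ∀ z, f z = wordMap S v (h z) := fun z => by
    rw [ht, hdef]
    simp [smul_smul, hr.ne']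
  have hbase : ∀ z, f z ∈ segment ℝ (wordMap S v (0, 0)) (wordMap S v (4, 0)) →
      h z ∈ segment ℝ ((0, 0) : ℝ × ℝ) (4, 0) := by
    rintro z ⟨p, q, hp, hq, hpq, hz⟩
    refine ⟨p, q, hp, hq, hpq, ?_⟩
    rw [hdef]
    dsimp only
    rw [← hz, ht, ht, eq_inv_smul_iff₀ hr.ne']
    ext
    · simp only [Prod.fst_add, Prod.smul_fst, Prod.fst_sub, smul_eq_mul]
      linear_combination (-t.1) * hpq
    · simp only [Prod.snd_add, Prod.smul_snd, Prod.snd_sub, smul_eq_mul]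
      linear_combination (-t.2) * hpq
  have hA := hbase _ (hv (left_mem_segment ℝ _ _))
  have hB := hbase _ (hv (right_mem_segment ℝ _ _))
  obtain ⟨a', b', d', e', ha', hh⟩ : ∃ a' b' d' e' : ℝ, a' ≠ 0 ∧ h = upper a' b' d' e' := by
    have h0 : g = t.2 := by
      have := snd_eq_of_mem_segment (p := (0, 0)) (q := (4, 0)) rfl hA
      simpa [hdef, hf, hr.ne', sub_eq_zero] using this
    refine ⟨r⁻¹ * a, r⁻¹ * b, r⁻¹ * d, r⁻¹ * (e - t.1), by positivity, ?_⟩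
    ext1 z
    rw [hdef]
    dsimp only
    rw [hf]
    ext <;> simp [upper, h0] <;> ring
  have hAT := K_subset_T (base_segment_subset hA)
  have hBT := K_subset_T (base_segment_subset hB)
  rw [hh] at hAT hBT
  simp only [T, upper, mem_ofPred_eq, mul_zero, add_zero, zero_add] at hAT hBT
  obtain ⟨hA1, -, hA2⟩ := hAT
  obtain ⟨hB1, -, hB2⟩ := hBT
  have hroot : h (2, 0) ∈ K \ vertices := by
    rw [hh, Set.mem_sdiff, mem_vertices]
    refine ⟨?_, ?_⟩
    · have := base_mem_K (x := a' * 2 + e') (by linarith) (by linarith)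
      simpa [upper] using this
    · simp only [upper, mul_zero, add_zero, and_true]
      rintro (h0 | h0 | h0)
      · exact ha' (by linarith)
      · exact ha' (by linarith)
      · linarith [h0.2]
  -- near the image of `(2, 0)` the dendrite coincides with this piece
  have hnear : ∀ᶠ z in 𝓝 ((2, 0) : ℝ × ℝ), f z ∉ K \ wordMap S v '' (K \ vertices) := by
    refine hcont.continuousAt.eventually
      ((isClosed_diff_wordMap_image v).1.isOpen_compl.mem_nhds fun hmem => hmem.2 ?_)
    rw [hfh]
    exact mem_image_of_mem _ hroot
  obtain ⟨ε, hε, hball⟩ := Metric.eventually_nhds_iff.1 hnear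
  obtain ⟨n, hn⟩ := exists_one_div_two_pow_lt (ε := ε / 4) (by linarith)
  have hmaps : ∀ z ∈ K, h (H 2 (1 / 2 ^ n) z) ∈ K := by
    intro z hz
    have hzK := H_two_mem_K n hz
    have hdist : dist (H 2 (1 / 2 ^ n) z) (2, 0) < ε := by
      have e1 : H 2 (1 / 2 ^ n) z - (2, 0) = (1 / 2 ^ n : ℝ) • (z - (2, 0)) := by
        ext <;> simp [H]
      rw [dist_eq_norm, e1, norm_smul, ← dist_eq_norm, Real.norm_of_nonneg (by positivity)]
      have := dist_le_of_mem_T (K_subset_T hz) (K_subset_T root_mem_U.1)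
      have h0 : (0 : ℝ) < 1 / 2 ^ n := by positivity
      nlinarith
    have := hball hdist
    simp only [Set.mem_sdiff, not_and, not_not] at this
    obtain ⟨u, hu, huz⟩ := this (hK hzK)
    rw [hfh] at huz
    rw [← wordMap_injective v huz]
    exact hu.1
  have hcomp : ∀ z, h (H 2 (1 / 2 ^ n) z) = upper (a' / 2 ^ n) (b' / 2 ^ n) (d' / 2 ^ n)
      (a' * (2 - 2 / 2 ^ n) + e') z := by
    intro z
    rw [hh]
    ext <;> simp only [upper, H] <;> ring
  have hpow : (0 : ℝ) < 2 ^ n := by positivity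
  obtain ⟨r1, r2, r3⟩ := upper_rigid (div_ne_zero ha' hpow.ne')
    (fun z hz => hcomp z ▸ hmaps z hz) (fun z hz z' hz' hzz => by
      rw [← hcomp, ← hcomp] at hzz
      have := hinj (H_two_mem_K n hz) (H_two_mem_K n hz') (by rw [hfh, hfh, hzz])
      rw [← H_two_eq_wordMap] at this
      exact wordMap_injective _ this)
  obtain rfl : b' = 0 := by simpa [hpow.ne'] using r1
  obtain rfl : a' = d' := by field_simp at r2; exact r2
  have ha0 : 0 < a' := by
    rw [div_pos_iff_of_pos_right hpow] at r3
    exact r3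
  -- So far `h` was controlled only near `(2, 0)`. As a homothety mapping the base into itself it
  -- maps `T` into `T`, and inside `T` membership in `K` can be tested after applying `wordMap S v`.
  obtain ⟨w, hw⟩ := homothety_eq_wordMap (c := a') (e := e') ha0 (fun z hz => by
    refine mem_wordMap_image_of_mem_T v ?_ (by rw [← hh, ← hfh]; exact hK hz)
    obtain ⟨z1, z2, z3⟩ := K_subset_T hz
    refine ⟨?_, ?_, ?_⟩ <;> simp only [upper] <;> nlinarith)
  refine ⟨v ++ w, ?_⟩
  ext1 z
  rw [wordMap_append, hfh, hh, hw]

/-! ### Back to the Euclidean plane -/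

/-- An attractor of a system of contractions is contained in every other one. -/
lemma attractor_subset {X : Type*} [MetricSpace X] {m : ℕ} {F : Fin m → X → X} {K L : Set X}
    (hF : ∀ k, IsContraction (F k)) (hK : IsAttractor F K) (hL : IsAttractor F L) : L ⊆ K := by
  obtain ⟨hKn, hKc, hKe⟩ := hK
  obtain ⟨hLn, hLc, hLe⟩ := hL
  -- The point of `L` farthest from `K` is the image of a point of `L` under a contraction
  -- preserving `K`, so the maximal distance is at most `c < 1` times itself.
  obtain ⟨z, hz, hmax⟩ := hLc.exists_isMaxOn hLn (Metric.continuous_infDist_pt K).continuousOn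
  have hmax' : ∀ y ∈ L, Metric.infDist y K ≤ Metric.infDist z K := fun y hy => hmax hy
  have hz0 : Metric.infDist z K ≤ 0 := by
    have hz' := hz
    rw [hLe] at hz'
    obtain ⟨k, y, hy, hyz⟩ := mem_iUnion.1 hz'
    obtain ⟨c, hc, hlip⟩ := hF k
    obtain ⟨p, hp, hpd⟩ := hKc.exists_infDist_eq_dist hKn y
    have h1 : F k p ∈ K := by
      rw [hKe]
      exact mem_iUnion.2 ⟨k, p, hp, rfl⟩
    have h2 : Metric.infDist z K ≤ c * Metric.infDist z K := by
      calc Metric.infDist z K ≤ dist z (F k p) := Metric.infDist_le_dist_of_mem h1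
        _ = dist (F k y) (F k p) := by rw [hyz]
        _ ≤ c * dist y p := hlip.dist_le_mul _ _
        _ = c * Metric.infDist y K := by rw [hpd]
        _ ≤ c * Metric.infDist z K := mul_le_mul_of_nonneg_left (hmax' y hy) c.2
    have h3 : (c : ℝ) < 1 := by exact_mod_cast hc
    nlinarith
  intro y hy
  rw [← hKc.isClosed.closure_eq, Metric.mem_closure_iff_infDist_zero hKn]
  exact le_antisymm ((hmax' y hy).trans hz0) Metric.infDist_nonneg

lemma sqrt_three_pos : 0 < √(3 : ℝ) := by positivity

/-- The skew coordinates on the Euclidean plane. -/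
noncomputable def skewLinear : Plane ≃ₗ[ℝ] ℝ × ℝ where
  toFun p := (p 0 - p 1 / √3, 2 * p 1 / √3)
  invFun z := !₂[z.1 + z.2 / 2, √3 / 2 * z.2]
  map_add' p q := by ext <;> simp <;> ring
  map_smul' c p := by ext <;> simp <;> ring
  left_inv p := by
    have := sqrt_three_pos.ne'
    ext i
    fin_cases i
    · simp
      ring
    · simp
  right_inv z := by
    have := sqrt_three_pos.ne'
    ext
    · simp
      field_simp
      ring
    · simp
      field_simp

/-- The skew coordinates as a homeomorphism. -/
noncomputable def skew : Plane ≃L[ℝ] ℝ × ℝ := skewLinear.toContinuousLinearEquiv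

lemma skew_apply (p : Plane) : skew p = (p 0 - p 1 / √3, 2 * p 1 / √3) := rfl

lemma skew_symm_apply (z : ℝ × ℝ) : skew.symm z = !₂[z.1 + z.2 / 2, √3 / 2 * z.2] := rfl

lemma skew_dendriteSystem (k : Fin 5) (p : Plane) :
    skew (dendriteSystem k p) = S k (skew p) := by
  have := sqrt_three_pos.ne'
  have h3 : √(3 : ℝ) * √3 = 3 := Real.mul_self_sqrt (by norm_num)
  fin_cases k <;> ext <;> simp [dendriteSystem, skew_apply] <;> field_simp <;> ring

lemma dendriteSystem_eq (k : Fin 5) : ∃ t, ∀ p, dendriteSystem k p = ratio k • p + t := by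
  fin_cases k <;> exact ⟨_, fun p => rfl⟩

lemma dist_dendriteSystem (k : Fin 5) (p q : Plane) :
    dist (dendriteSystem k p) (dendriteSystem k q) = ratio k * dist p q := by
  obtain ⟨t, ht⟩ := dendriteSystem_eq k
  rw [ht, ht, dist_add_right, dist_smul₀, Real.norm_of_nonneg (ratio_pos k).le]

lemma isSimilarity_dendriteSystem (k : Fin 5) : IsSimilarity (dendriteSystem k) :=
  ⟨ratio k, ratio_pos k, dist_dendriteSystem k⟩

lemma isContraction_dendriteSystem (k : Fin 5) : IsContraction (dendriteSystem k) := by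
  refine ⟨1 / 2, by rw [← NNReal.coe_lt_coe]; norm_num, LipschitzWith.of_dist_le_mul
    fun p q => ?_⟩
  rw [dist_dendriteSystem]
  exact mul_le_mul_of_nonneg_right (by simpa using ratio_le k) dist_nonneg

lemma skew_wordMap (w : List (Fin 5)) (p : Plane) :
    skew (wordMap dendriteSystem w p) = wordMap S w (skew p) := by
  induction w with
  | nil => rfl
  | cons k w ih =>
    rw [wordMap_cons, ← ih, ← skew_dendriteSystem]
    rfl

/-! ### Properties of the attractor in the plane. -/

/-- The attractor in the Euclidean plane. -/
def planeK : Set Plane := skew ⁻¹' K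

lemma isAttractor_planeK : IsAttractor dendriteSystem planeK := by
  refine ⟨⟨skew.symm (0, 0), by simpa [planeK] using A_mem_K⟩,
    skew.toHomeomorph.isCompact_preimage.2 isCompact_K, ?_⟩
  ext p
  simp only [planeK, mem_iUnion, mem_preimage]
  constructor
  · intro hp
    obtain ⟨k, z, hz, hzp⟩ := exists_mem_S_image hp
    refine ⟨k, skew.symm z, by simpa using hz, skew.injective ?_⟩
    rw [skew_dendriteSystem, skew.apply_symm_apply, hzp]
  · rintro ⟨k, q, hq, rfl⟩
    rw [skew_dendriteSystem]
    exact S_mem_K k hq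

lemma isDendrite_planeK : IsDendrite planeK where
  isCompact := isAttractor_planeK.2.1
  isConnected := skew.toHomeomorph.isConnected_preimage.2 isConnected_K
  locallyConnected :=
    haveI := locallyConnectedSpace_K
    (skew.toHomeomorph.subtype (p := (· ∈ planeK)) (q := (· ∈ K))
      fun _ => Iff.rfl).locallyConnectedSpace
  no_simple_closed_curve := by
    rintro ⟨γ, hγ, hinj, hr⟩
    exact no_circle_in_K (skew.continuous.comp hγ) (skew.injective.comp hinj)
      fun t => hr (mem_range_self t)

lemma image_skew_segment (p q : Plane) :
    skew '' segment ℝ p q = segment ℝ (skew p) (skew q) :=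
  image_segment ℝ (skew : Plane →ₗ[ℝ] ℝ × ℝ).toAffineMap p q

lemma segment_subset_planeK {p q : Plane} :
    segment ℝ p q ⊆ planeK ↔ segment ℝ (skew p) (skew q) ⊆ K := by
  rw [← image_skew_segment, image_subset_iff]
  rfl

lemma segment_subset_segment_iff {p q p' q' : Plane} :
    segment ℝ p q ⊆ segment ℝ p' q' ↔
      segment ℝ (skew p) (skew q) ⊆ segment ℝ (skew p') (skew q') := by
  rw [← image_skew_segment, ← image_skew_segment, image_subset_image_iff skew.injective]

lemma MaxSegment.isMaximalSegment {p q : Plane} (h : MaxSegment K (skew p) (skew q)) :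
    IsMaximalSegment planeK p q := by
  refine ⟨segment_subset_planeK.2 h.1, fun p' q' h' hsub => ?_⟩
  have := h.2 _ _ (segment_subset_planeK.1 h') (segment_subset_segment_iff.1 hsub)
  rw [← image_skew_segment, ← image_skew_segment] at this
  exact skew.injective.image_injective this

lemma segments_planeK {p q : Plane} (hne : p ≠ q) (h : segment ℝ p q ⊆ planeK) :
    p 1 = q 1 ∧ ∃ (p' q' : Plane) (n : ℕ), IsMaximalSegment planeK p' q' ∧
      segment ℝ p q ⊆ segment ℝ p' q' ∧ dist p' q' = 4 / 2 ^ n := by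
  have h' := segment_subset_planeK.1 h
  have hs := sqrt_three_pos.ne'
  constructor
  · have := snd_eq_of_segment_subset h'
    simp only [skew_apply] at this
    field_simp at this
    linarith
  · obtain ⟨w, n, hw, hsub, hlen⟩ := exists_maxSegment (skew.injective.ne hne) h'
    refine ⟨skew.symm (wordMap S w (0, 0)), skew.symm (wordMap S w (4, 0)), n,
      MaxSegment.isMaximalSegment (by simpa using hw),
      segment_subset_segment_iff.2 (by simpa using hsub), ?_⟩
    have hsnd := snd_eq_of_segment_subset hw.1
    rw [EuclideanSpace.dist_eq, Fin.sum_univ_two]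
    simp only [skew_symm_apply, hsnd]
    simp [Real.dist_eq, Real.sqrt_sq_eq_abs]
    rw [abs_sub_comm, hlen, abs_of_pos (by positivity)]

lemma affine_planeK (f : Plane →ᵃ[ℝ] Plane) (hinj : InjOn f planeK)
    (hf : MapsTo f planeK planeK) : ∃ w : List (Fin 5), ⇑f = wordMap dendriteSystem w := by
  set g : (ℝ × ℝ) →ᵃ[ℝ] (ℝ × ℝ) := (skew : Plane →ₗ[ℝ] ℝ × ℝ).toAffineMap.comp
    (f.comp (skew.symm : ℝ × ℝ →ₗ[ℝ] Plane).toAffineMap) with hg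
  have hgf : ∀ z, g z = skew (f (skew.symm z)) := fun z => rfl
  have hmem : ∀ z ∈ K, skew.symm z ∈ planeK := fun z hz => by simpa [planeK] using hz
  obtain ⟨w, hw⟩ := affine_eq_wordMap g
    (fun z hz z' hz' h => skew.symm.injective
      (hinj (hmem z hz) (hmem z' hz') (skew.injective h)))
    (fun z hz => hf (hmem z hz))
  refine ⟨w, ?_⟩
  ext1 p
  refine skew.injective ?_
  rw [skew_wordMap, ← hw, hgf, skew.symm_apply_apply]

lemma exists_wordMap_dendriteSystem_eq (w : List (Fin 5)) :
    ∃ (r : ℝ) (b : Plane), ∀ p, wordMap dendriteSystem w p = r • p + b := by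
  induction w with
  | nil => exact ⟨1, 0, fun p => by simp [wordMap]⟩
  | cons k w ih =>
    obtain ⟨r, b, h⟩ := ih
    obtain ⟨t, ht⟩ := dendriteSystem_eq k
    refine ⟨ratio k * r, ratio k • b + t, fun p => ?_⟩
    rw [← add_assoc, mul_smul, ← smul_add, ← h, ← ht]
    rfl

/-! ### Zippers. -/

lemma not_selfAffineZipper : ¬ IsSelfAffineZipperAttractor planeK := by
  rintro ⟨m, φ, z, ε, hz, haff, hn, hc, he⟩
  have hmaps : ∀ j, MapsTo (φ j) planeK planeK := fun j p hp => by
    rw [he]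
    exact mem_iUnion.2 ⟨j, p, hp, rfl⟩
  have hhom : ∀ j, ∃ (r : ℝ) (b : Plane), ∀ p, φ j p = r • p + b := by
    intro j
    obtain ⟨g, hg⟩ := haff j
    obtain ⟨w, hw⟩ := affine_planeK g (hg ▸ (hz.injective j).injOn) (hg ▸ hmaps j)
    obtain ⟨r, b, h⟩ := exists_wordMap_dendriteSystem_eq w
    exact ⟨r, b, fun p => by rw [← hg, hw, h]⟩
  -- a linear form that vanishes on the line through the end vertices
  set v := z (Fin.last m) - z 0 with hv
  obtain ⟨α, β, hαβ, hker⟩ : ∃ α β : ℝ, (α ≠ 0 ∨ β ≠ 0) ∧ α * v 0 + β * v 1 = 0 := by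
    by_cases h0 : v 0 = 0
    · exact ⟨1, 0, by simp, by simp [h0]⟩
    · exact ⟨-v 1, v 0, Or.inr h0, by ring⟩
  set n : Plane → ℝ := fun p => α * p 0 + β * p 1 with hndef
  have hnlin : ∀ (r : ℝ) (p q : Plane), n (r • p + q) = r * n p + n q := fun r p q => by
    simp [hndef]; ring
  have hnends : n (z (Fin.last m)) = n (z 0) := by
    simp only [hv, PiLp.sub_apply] at hker
    simp only [hndef]
    linarith
  -- A homothety preserves the equality of the form at the two end vertices, so consecutive vertices
  -- have equal values, whatever the signature.
  have hstep : ∀ j : Fin m, n (z j.succ) = n (z j.castSucc) := by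
    intro j
    obtain ⟨r, b, h⟩ := hhom j
    have h1 : n (φ j (z 0)) = n (φ j (z (Fin.last m))) := by rw [h, h, hnlin, hnlin, hnends]
    rw [hz.map_initial, hz.map_final] at h1
    split_ifs at h1
    exacts [h1, h1.symm]
  have hall : ∀ i, n (z i) = n (z 0) := fun i => by
    induction i using Fin.induction with
    | zero => rfl
    | succ j ih => rw [hstep, ih]
  have hscale : ∀ j, ∃ c : ℝ, |c| < 1 ∧ ∀ p, n (φ j p) - n (z 0) = c * (n p - n (z 0)) := by
    intro j
    obtain ⟨r, b, h⟩ := hhom j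
    refine ⟨r, ?_, fun p => ?_⟩
    · obtain ⟨c, hc1, hlip⟩ := hz.contraction j
      have h1 := hlip.dist_le_mul (!₂[1, 0]) 0
      have h2 : dist (!₂[1, 0] : Plane) 0 = 1 := by
        rw [EuclideanSpace.dist_eq, Fin.sum_univ_two]
        simp
      rw [h, h, dist_add_right, dist_smul₀, h2, mul_one, mul_one, Real.norm_eq_abs] at h1
      exact h1.trans_lt (by exact_mod_cast hc1)
    · have h1 : n (φ j (z 0)) = n (z 0) := by
        rw [hz.map_initial]
        split_ifs <;> exact hall _
      rw [h, hnlin] at h1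
      rw [h, hnlin]
      linear_combination h1
  have hcont : Continuous fun p => |n p - n (z 0)| := by
    simp only [hndef]
    fun_prop
  -- Every zipper map contracts the deviation of the form from its value at the vertices, so the
  -- maximal deviation on the attractor is zero.
  obtain ⟨q, hq, hmax⟩ := hc.exists_isMaxOn hn hcont.continuousOn
  have hconst : ∀ p ∈ planeK, n p = n (z 0) := by
    have hq0 : |n q - n (z 0)| ≤ 0 := by
      have hq' := hq
      rw [he] at hq'
      obtain ⟨j, p, hp, rfl⟩ := mem_iUnion.1 hq'
      obtain ⟨c, hc1, hc2⟩ := hscale j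
      have h1 : |n p - n (z 0)| ≤ |n (φ j p) - n (z 0)| := hmax hp
      rw [hc2, abs_mul] at h1 ⊢
      have := abs_nonneg (n p - n (z 0))
      have h2 : |n p - n (z 0)| = 0 := by nlinarith
      rw [h2, mul_zero]
    intro p hp
    have h1 : |n p - n (z 0)| ≤ |n q - n (z 0)| := hmax hp
    exact sub_eq_zero.1 (abs_eq_zero.1 (le_antisymm (h1.trans hq0) (abs_nonneg _)))
  have hA := hconst (skew.symm (0, 0)) (by simpa [planeK] using A_mem_K)
  have hB := hconst (skew.symm (4, 0)) (by simpa [planeK] using B_mem_K)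
  have hC := hconst (skew.symm (0, 4)) (by simpa [planeK] using C_mem_K)
  have hs := sqrt_three_pos
  simp [hndef, skew_symm_apply] at hA hB hC
  have hα : α = 0 := by linarith
  subst hα
  rcases hαβ with h | h
  · exact h rfl
  · have : β * √3 = 0 := by linarith
    exact (mul_ne_zero h hs.ne') this

/-- Dividing by the ratio leaves an isometry, which is affine because the Euclidean plane is
strictly convex. -/
lemma exists_affineMap_of_isSimilarity {f : Plane → Plane} (hf : IsSimilarity f) :
    ∃ g : Plane →ᵃ[ℝ] Plane, ⇑g = f := by
  obtain ⟨r, hr, h⟩ := hf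
  have hiso : Isometry fun p => r⁻¹ • f p := Isometry.of_dist_eq fun p q => by
    rw [dist_smul₀, h, Real.norm_of_nonneg (by positivity), inv_mul_cancel_left₀ hr.ne']
  refine ⟨r • hiso.affineIsometryOfStrictConvexSpace.toAffineMap, ?_⟩
  ext1 p
  simp [smul_smul, hr.ne']

lemma not_selfSimilarZipper : ¬ IsSelfSimilarZipperAttractor planeK := by
  rintro ⟨m, φ, z, ε, hz, hs, hK⟩
  exact not_selfAffineZipper ⟨m, φ, z, ε, hz, fun j => exists_affineMap_of_isSimilarity (hs j), hK⟩

end DendriteModel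

theorem mainTheorem1 :
    (∀ k, IsSimilarity (dendriteSystem k) ∧ IsContraction (dendriteSystem k)) ∧
    (∃ K : Set Plane,
      -- `K` is the unique attractor of the system, and it is a dendrite
      IsAttractor dendriteSystem K ∧
      (∀ L : Set Plane, IsAttractor dendriteSystem L → L = K) ∧
      IsDendrite K ∧
      -- non-degenerate segments in `K` are horizontal and lie in maximal ones
      (∀ p q : Plane, p ≠ q → segment ℝ p q ⊆ K →
        p 1 = q 1 ∧
        ∃ (p' q' : Plane) (n : ℕ), IsMaximalSegment K p' q' ∧
          segment ℝ p q ⊆ segment ℝ p' q' ∧ dist p' q' = 4 / 2 ^ n) ∧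
      -- injective affine self-maps of `K` are compositions of the maps of the system
      (∀ f : Plane →ᵃ[ℝ] Plane, Set.InjOn f K → Set.MapsTo f K K →
        ∃ w : List (Fin 5), ⇑f = wordMap dendriteSystem w) ∧
      -- `K` is not the attractor of a self-similar, or even self-affine, zipper
      ¬ IsSelfSimilarZipperAttractor K ∧
      ¬ IsSelfAffineZipperAttractor K) ∧
    -- there are self-similar continua that no self-similar zipper produces
    (∃ (m : ℕ) (F : Fin m → Plane → Plane) (L : Set Plane),
      (∀ i, IsSimilarity (F i) ∧ IsContraction (F i)) ∧ IsAttractor F L ∧ IsConnected L ∧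
      ¬ IsSelfSimilarZipperAttractor L) := by
  have hS : ∀ k, IsSimilarity (dendriteSystem k) ∧ IsContraction (dendriteSystem k) := fun k =>
    ⟨DendriteModel.isSimilarity_dendriteSystem k, DendriteModel.isContraction_dendriteSystem k⟩
  have hK := DendriteModel.isAttractor_planeK
  refine ⟨hS, ⟨DendriteModel.planeK, hK, fun L hL => ?_, DendriteModel.isDendrite_planeK,
    fun p q hne h => DendriteModel.segments_planeK hne h, DendriteModel.affine_planeK,
    DendriteModel.not_selfSimilarZipper, DendriteModel.not_selfAffineZipper⟩,
    5, dendriteSystem, DendriteModel.planeK, hS, hK, DendriteModel.isDendrite_planeK.isConnected,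
    DendriteModel.not_selfSimilarZipper⟩
  exact Set.Subset.antisymm (DendriteModel.attractor_subset (fun k => (hS k).2) hK hL)
    (DendriteModel.attractor_subset (fun k => (hS k).2) hL hK)
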